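/- Let $d\ge 2$ be an integer, $s>0$, and $\beta>\frac{3-2d}{4}$. Put $\phi_s(r)=\sqrt{s^2+r^2}$, let $\widehat f(\xi)=\int_{\mathbb R^d}e^{-ix\cdot\xi}f(x)\,dx$ (extended to $L^2(\mathbb R^d)$ by Plancherel), and let $e^{it\phi_s(D)}f$ be the Klein--Gordon propagator, i.e. $e^{it\phi_s(D)}f(x)=(2\pi)^{-d}\int_{\mathbb R^d}e^{i(x\cdot\xi+t\phi_s(|\xi|))}\widehat f(\xi)\,d\xi$. Let $|\square-(2s)^2|^\beta$ denote the space-time Fourier multiplier with symbol $\bigl|\tau^2-|\xi|^2-(2s)^2\bigr|^\beta$, where $(\tau,\xi)\in\mathbb R\times\mathbb R^d$ is the variable dual to $(t,x)$, and define $$\mathcal K_{1/2}^{b}(\eta_1,\eta_2)=\frac{\bigl(\phi_s(|\eta_1|)\phi_s(|\eta_2|)-\eta_1\cdot\eta_2-s^2\bigr)^{b}}{\bigl(\phi_s(|\eta_1|)\phi_s(|\eta_2|)-\eta_1\cdot\eta_2+s^2\bigr)^{1/2}},\qquad \mathbf{KG}_{(++)}(\beta,d)=2^{\frac{-5d+1}{2}+2\beta}\,\pi^{\frac{-5d+1}{2}}\,\frac{\Gamma(\frac{d-1}{2})}{\Gamma(d-1)}.$$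 Then for all $f,g\in L^2(\mathbb R^d)$, $$\bigl\||\square-(2s)^2|^\beta\bigl(e^{it\phi_s(D)}f\;e^{it\phi_s(D)}g\bigr)\bigr\|_{L^2(\mathbb R^{d+1})}^2\le \mathbf{KG}_{(++)}(\beta,d)\int_{\mathbb R^{2d}}|\widehat f(\eta_1)|^2|\widehat g(\eta_2)|^2\phi_s(|\eta_1|)\phi_s(|\eta_2|)\,\mathcal K_{1/2}^{\frac{d-2}{2}+2\beta}(\eta_1,\eta_2)\,d\eta_1\,d\eta_2,$$ as an inequality in $[0,\infty]$; in particular, whenever the right-hand side is finite, $|\square-(2s)^2|^\beta(e^{it\phi_s(D)}f\,e^{it\phi_s(D)}g)$ is well defined as an element of $L^2(\mathbb R^{d+1})$. Moreover, for each such $d,s,\beta$ the constant $\mathbf{KG}_{(++)}(\beta,d)$ is sharp: it cannot be replaced by a smaller one, even if $f$ and $g$ are restricted to Schwartz functions. -/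

import Mathlib

open MeasureTheory
open scoped FourierTransform SchwartzMap ENNReal

noncomputable section

namespace KleinGordon

/-- Space `ℝ^d` with its Euclidean norm. -/
abbrev Space (d : ℕ) := EuclideanSpace ℝ (Fin d)

/-- Space-time `ℝ × ℝ^d = ℝ^{d+1}` with its Euclidean norm and Lebesgue measure; a point is a pair
`(t, x)`, or `(τ, ξ)` on the frequency side. -/
abbrev SpaceTime (d : ℕ) := WithLp 2 (ℝ × Space d)

/-- Square integrable complex functions on `ℝ^d`. -/
abbrev L2 (d : ℕ) := Lp (α := Space d) ℂ 2 volume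

/-- Square integrable complex functions on `ℝ^{d+1}`. -/
abbrev L2ST (d : ℕ) := Lp (α := SpaceTime d) ℂ 2 volume

/-- `φ_s(r) = √(s² + r²)`. -/
def phi (s r : ℝ) : ℝ := Real.sqrt (s ^ 2 + r ^ 2)

/-- The Fourier transform `f̂(ξ) = ∫ e^{-i x·ξ} f(x) dx` of an `L²` function. Mathlib's transform `𝓕`
(extended to `L²` by Plancherel) has the kernel `e^{-2πi x·ξ}`, hence the scaling. -/
def hat {d : ℕ} (f : L2 d) (ξ : Space d) : ℂ :=
  (𝓕 f : L2 d) ((2 * Real.pi)⁻¹ • ξ)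

theorem memLp_phase_mul {d : ℕ} (s t : ℝ) (h : L2 d) :
    MemLp (fun ξ : Space d =>
      Complex.exp (((t * phi s (2 * Real.pi * ‖ξ‖) : ℝ) : ℂ) * Complex.I) * h ξ) 2 := by
  have hc : Continuous (fun ξ : Space d =>
      Complex.exp (((t * phi s (2 * Real.pi * ‖ξ‖) : ℝ) : ℂ) * Complex.I)) := by
    unfold phi
    fun_prop
  refine (Lp.memLp h).of_le (hc.aestronglyMeasurable.mul (Lp.aestronglyMeasurable h)) ?_
  refine Filter.Eventually.of_forall fun ξ => ?_
  rw [norm_mul, Complex.norm_exp_ofReal_mul_I, one_mul]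

/-- The Klein–Gordon propagator
`e^{itφ_s(D)} f(x) = (2π)^{-d} ∫ e^{i (x·ξ + t φ_s(|ξ|))} f̂(ξ) dξ` on `L²(ℝ^d)`; with Mathlib's
normalisation of `𝓕`, the frequency variable `ξ` becomes `2πξ`. -/
def propagator {d : ℕ} (s t : ℝ) (f : L2 d) : L2 d :=
  𝓕⁻ ((memLp_phase_mul s t (𝓕 f : L2 d)).toLp _)

/-- `(t, x) ↦ e^{itφ_s(D)} f(x) · e^{itφ_s(D)} g(x)` (both factors without conjugation). For each
`t` it is an integrable function of `x`, with `L¹` norm at most `‖f‖ ‖g‖`. -/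
def productPP {d : ℕ} (s : ℝ) (f g : L2 d) (t : ℝ) (x : Space d) : ℂ :=
  propagator s t f x * propagator s t g x

/-- The space-time Fourier transform, in the sense of distributions, of the field `W` is the locally
integrable function `H`:  `⟨H, ψ⟩ = ⟨W, 𝓕 ψ⟩` for all test functions `ψ ∈ C_c^∞(ℝ^{d+1})`. It is
meant for fields with `sup_t ‖W t‖_{L¹} < ∞`, for which the pairing on the left converges. The
function `H` is determined by `W` almost everywhere. -/
def HasSpaceTimeFourier {d : ℕ} (W : ℝ → Space d → ℂ) (H : SpaceTime d → ℂ) : Prop :=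
  LocallyIntegrable H ∧
    ∀ ψ : 𝓢(SpaceTime d, ℂ), HasCompactSupport ψ →
      ∫ t : ℝ, ∫ x : Space d, W t x * (𝓕 ψ : 𝓢(SpaceTime d, ℂ)) (WithLp.toLp 2 (t, x))
        = ∫ p : SpaceTime d, H p * ψ p

/-- The symbol `|τ² - |ξ|² - (2s)²|` of the null form `|□ - (2s)²|`, at the frequency
`(τ, ξ) = 2πp`, where `p` is the frequency variable of Mathlib's `𝓕`. -/
def nullSymbol {d : ℕ} (s : ℝ) (p : SpaceTime d) : ℝ :=
  |(2 * Real.pi * p.fst) ^ 2 - (2 * Real.pi * ‖p.snd‖) ^ 2 - (2 * s) ^ 2|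

/-- `G ∈ L²(ℝ^{d+1})` is `|□ - (2s)²|^β W`: its Fourier transform is the one of `W` times the
symbol to the power `β`. -/
def IsNullFormPower {d : ℕ} (s β : ℝ) (W : ℝ → Space d → ℂ)
    (G : L2ST d) : Prop :=
  ∃ H : SpaceTime d → ℂ, HasSpaceTimeFourier W H ∧
    (𝓕 G : L2ST d) =ᵐ[volume]
      fun p => ((nullSymbol s p ^ β : ℝ) : ℂ) * H p

/-- `‖ |□ - (2s)²|^β W ‖²_{L²(ℝ^{d+1})}`, which is `∞` if `|□ - (2s)²|^β W` is not in `L²`. (There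
is at most one `G` as in the infimum.) -/
def nullFormNormSq {d : ℕ} (s β : ℝ) (W : ℝ → Space d → ℂ) : ℝ≥0∞ :=
  ⨅ (G : L2ST d) (_ : IsNullFormPower s β W G), ‖G‖ₑ ^ 2

/-- The kernel `𝒦_a^b(η₁, η₂)`. -/
def kernel {d : ℕ} (s a b : ℝ) (η₁ η₂ : Space d) : ℝ :=
  (phi s ‖η₁‖ * phi s ‖η₂‖ - inner ℝ η₁ η₂ - s ^ 2) ^ b /
    (phi s ‖η₁‖ * phi s ‖η₂‖ - inner ℝ η₁ η₂ + s ^ 2) ^ a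

/-- `∫ |f̂(η₁)|² |ĝ(η₂)|² φ_s(|η₁|) φ_s(|η₂|) 𝒦_{1/2}^{(d-2)/2+2β}(η₁, η₂) dη₁ dη₂`, with values in
`[0, ∞]` (the integrand is nonnegative). -/
def dataIntegral {d : ℕ} (s β : ℝ) (f g : L2 d) : ℝ≥0∞ :=
  ∫⁻ η : Space d × Space d, ENNReal.ofReal
    (‖hat f η.1‖ ^ 2 * ‖hat g η.2‖ ^ 2 * phi s ‖η.1‖ * phi s ‖η.2‖ *
      kernel s (1 / 2) (((d : ℝ) - 2) / 2 + 2 * β) η.1 η.2)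

/-- The constant `KG_{(++)}(β, d)`. -/
def KGpp (β : ℝ) (d : ℕ) : ℝ :=
  (2 : ℝ) ^ ((-5 * (d : ℝ) + 1) / 2 + 2 * β) * Real.pi ^ ((-5 * (d : ℝ) + 1) / 2) *
    (Real.Gamma (((d : ℝ) - 1) / 2) / Real.Gamma ((d : ℝ) - 1))

end KleinGordon

end

/-! In the normalisation of Mathlib's `𝓕` put m = s/(2π), ω(ξ) = √(m² + |ξ|²), F = `𝓕 f`, G = `𝓕 g`.
A product of two waves superposes characters with frequencies Φ(ξ, η) = (ω(ξ) + ω(η), ξ + η), so its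
space-time Fourier transform H is the image under Φ of F(ξ)G(η) dξ dη (`integral_productPP`).

Everything rests on the explicit image of the Lorentz-invariant measure dξ dη / (ω(ξ)ω(η)) under Φ
(`lintegral_momentum`). A boost to the rest frame of the pair reduces it to polar coordinates, and
the density depends only on τ² - |ζ|² above the threshold. On the image, τ² - |ζ|² - 4m² =
2(ω(ξ)ω(η) - ξ·η - m²), so both the density and the null symbol are explicit in (ξ, η); together
they give exactly the kernel and the constant (`nullSymbol_mul_collisionDensity`). Cauchy-Schwarz on
the fibres of Φ (`exists_density_map`) bounds |H|² by the density times the fibre integral of |FG|²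
ωω, and integration against the squared symbol yields the inequality.

Equality holds on the fibres when F(ξ)G(η)ω(ξ)ω(η) is a function of Φ(ξ, η), for instance for F = G
= e^{-ω}/ω. Smooth cutoffs turn this profile into Schwartz data. A cutoff at radius n + 1 does not
affect H where τ < n + 1, because |ξ| ≤ ω(ξ), while it can only decrease the right-hand side. With M
the common value of both sides for the full profile, monotone convergence gives KG · M ≤ C · M, and
0 < M < ∞ allows cancellation (`KGpp_le_of_forall_schwartz`). -/

noncomputable section

namespace KleinGordon

/-! ### Lorentz boosts on a line -/

/-- The change of variables `y = w √(z² + μ²) / μ`, `μ = 2 √(M² + w²)`. -/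
def boost (M z w : ℝ) : ℝ := w * Real.sqrt (1 + z ^ 2 / (4 * (M ^ 2 + w ^ 2)))

/-- Two particles with rest-frame momenta ±w have energy ν = √(M² + w²) each. Boosting the pair to
total momentum z has factor γ = τ/(2ν), with τ the total energy. The momenta become z/2 ± γw and the
energies γν ± (z/(2ν))w, so the total energy depends on w only through ν. -/
theorem boost_energy {M : ℝ} (hM : 0 < M) (z w : ℝ) :
    Real.sqrt (M ^ 2 + (z / 2 + boost M z w) ^ 2) =
      Real.sqrt (z ^ 2 + 4 * (M ^ 2 + w ^ 2)) / 2 + z * w / (2 * Real.sqrt (M ^ 2 + w ^ 2)) := by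
  have hν : 0 < M ^ 2 + w ^ 2 := by positivity
  set ν := Real.sqrt (M ^ 2 + w ^ 2) with hνd
  have hνp : 0 < ν := Real.sqrt_pos.2 hν
  have hν2 : ν ^ 2 = M ^ 2 + w ^ 2 := Real.sq_sqrt hν.le
  set τ := Real.sqrt (z ^ 2 + 4 * (M ^ 2 + w ^ 2)) with hτd
  have hτ2 : τ ^ 2 = z ^ 2 + 4 * (M ^ 2 + w ^ 2) := Real.sq_sqrt (by positivity)
  have hτp : 0 < τ := Real.sqrt_pos.2 (by positivity)
  have hb : boost M z w = w * (τ / (2 * ν)) := by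
    unfold boost
    congr 1
    rw [Real.sqrt_eq_iff_mul_self_eq (by positivity) (by positivity)]
    field_simp
    rw [hτ2, ← hν2]; ring
  have hpos : 0 ≤ τ / 2 + z * w / (2 * ν) := by
    have h1 : |z * w| ≤ τ * ν := by
      apply abs_le_of_sq_le_sq _ (by positivity)
      rw [mul_pow, mul_pow, hτ2, hν2]
      nlinarith [sq_nonneg (z * M), sq_nonneg (M ^ 2 + w ^ 2)]
    have h2 : -(τ * ν) ≤ z * w := (abs_le.1 h1).1
    have : τ / 2 + z * w / (2 * ν) = (τ * ν + z * w) / (2 * ν) := by field_simp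
    rw [this]
    apply div_nonneg <;> linarith
  rw [Real.sqrt_eq_iff_mul_self_eq (by positivity) hpos, hb]
  have e : M ^ 2 = ν ^ 2 - w ^ 2 := by linarith
  rw [e]
  have : τ ^ 2 = z ^ 2 + 4 * ν ^ 2 := by rw [hτ2, hν2]
  field_simp
  have h4 : τ ^ 2 * (w^2 - ν^2) = (z ^ 2 + 4 * ν ^ 2) * (w^2 - ν^2) := by rw [this]
  linarith

theorem boost_neg (M z w : ℝ) : boost M (-z) w = boost M z w := by
  simp [boost]

theorem boost_energy' {M : ℝ} (hM : 0 < M) (z w : ℝ) :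
    Real.sqrt (M ^ 2 + (z / 2 - boost M z w) ^ 2) =
      Real.sqrt (z ^ 2 + 4 * (M ^ 2 + w ^ 2)) / 2 - z * w / (2 * Real.sqrt (M ^ 2 + w ^ 2)) := by
  have := boost_energy hM (-z) w
  rw [boost_neg] at this
  rw [show (z / 2 - boost M z w) ^ 2 = (-z / 2 + boost M z w) ^ 2 by ring, this]
  ring_nf

/-- The Jacobian is written with the factor ω₊ω₋ so that it cancels the density 1/(ω₊ω₋): this is
the Lorentz invariance of the measure. -/
theorem hasDerivAt_boost {M : ℝ} (hM : 0 < M) (z w : ℝ) :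
    HasDerivAt (boost M z)
      (2 / (Real.sqrt (M ^ 2 + w ^ 2) * Real.sqrt (z ^ 2 + 4 * (M ^ 2 + w ^ 2))) *
      (Real.sqrt (M ^ 2 + (z / 2 + boost M z w) ^ 2) *
        Real.sqrt (M ^ 2 + (z / 2 - boost M z w) ^ 2))) w := by
  rw [boost_energy hM, boost_energy' hM]
  have hν : 0 < M ^ 2 + w ^ 2 := by positivity
  set ν := Real.sqrt (M ^ 2 + w ^ 2) with hνd
  have hνp : 0 < ν := Real.sqrt_pos.2 hν
  have hν2 : ν ^ 2 = M ^ 2 + w ^ 2 := Real.sq_sqrt hν.le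
  set τ := Real.sqrt (z ^ 2 + 4 * (M ^ 2 + w ^ 2)) with hτd
  have hτ2 : τ ^ 2 = z ^ 2 + 4 * (M ^ 2 + w ^ 2) := Real.sq_sqrt (by positivity)
  have hτp : 0 < τ := Real.sqrt_pos.2 (by positivity)
  have hs : Real.sqrt (1 + z ^ 2 / (4 * (M ^ 2 + w ^ 2))) = τ / (2 * ν) := by
    rw [Real.sqrt_eq_iff_mul_self_eq (by positivity) (by positivity)]
    field_simp
    rw [hτ2, ← hν2]; ring
  have h1 : HasDerivAt (fun w : ℝ => 4 * (M ^ 2 + w ^ 2)) (4 * (2 * w)) w := by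
    have := ((hasDerivAt_pow 2 w).const_add (M ^ 2)).const_mul 4
    simpa using this
  have h2 := (((hasDerivAt_const w (z ^ 2)).div h1 (by positivity)).const_add 1).sqrt
    (by simp only [Pi.div_apply]; positivity)
  have h3 := (hasDerivAt_id w).mul h2
  refine h3.congr_deriv ?_
  simp only [Pi.div_apply, hs, id]
  have : τ ^ 2 = z ^ 2 + 4 * ν ^ 2 := by rw [hτ2, hν2]
  rw [← hν2]
  field_simp
  -- The coefficient is zero: what remains is a polynomial identity that holds without the relation
  -- between τ, z and ν.
  linear_combination ν ^ 2 * (1-1) * this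

theorem strictMono_boost {M : ℝ} (hM : 0 < M) (z : ℝ) : StrictMono (boost M z) := by
  apply strictMono_of_hasDerivAt_pos (fun w => hasDerivAt_boost hM z w)
  intro w
  positivity

theorem surjective_boost {M : ℝ} (hM : 0 < M) (z : ℝ) : Function.Surjective (boost M z) := by
  have hc : Continuous (boost M z) :=
    continuous_iff_continuousAt.2 fun w => (hasDerivAt_boost hM z w).continuousAt
  have h1 (w : ℝ) : 1 ≤ Real.sqrt (1 + z ^ 2 / (4 * (M ^ 2 + w ^ 2))) := by
    rw [Real.one_le_sqrt]
    have : 0 ≤ z ^ 2 / (4 * (M ^ 2 + w ^ 2)) := by positivity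
    linarith
  apply hc.surjective
  · apply Filter.tendsto_atTop_mono' _ _ Filter.tendsto_id
    filter_upwards [Filter.eventually_ge_atTop 0] with w hw
    exact le_mul_of_one_le_right hw (h1 w)
  · apply Filter.tendsto_atBot_mono' _ _ Filter.tendsto_id
    filter_upwards [Filter.eventually_le_atBot 0] with w hw
    have := mul_le_mul_of_nonpos_left (h1 w) hw
    simpa [boost] using this

/-- Pushing the measure `dy / (ω₊ ω₋)` on the line forward along the total energy. -/
theorem lintegral_energy_line {M : ℝ} (hM : 0 < M) (z : ℝ) (h : ℝ → ℝ≥0∞) :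
    ∫⁻ y : ℝ, h (Real.sqrt (M ^ 2 + (z / 2 + y) ^ 2) + Real.sqrt (M ^ 2 + (z / 2 - y) ^ 2)) *
        ENNReal.ofReal (1 / (Real.sqrt (M ^ 2 + (z / 2 + y) ^ 2) *
          Real.sqrt (M ^ 2 + (z / 2 - y) ^ 2))) =
      ∫⁻ w : ℝ, h (Real.sqrt (z ^ 2 + 4 * (M ^ 2 + w ^ 2))) *
        ENNReal.ofReal (2 / (Real.sqrt (M ^ 2 + w ^ 2) *
          Real.sqrt (z ^ 2 + 4 * (M ^ 2 + w ^ 2)))) := by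
  have key := lintegral_image_eq_lintegral_abs_deriv_mul (s := Set.univ) MeasurableSet.univ
    (fun w _ => (hasDerivAt_boost hM z w).hasDerivWithinAt)
    (strictMono_boost hM z).injective.injOn
    (fun y => h (Real.sqrt (M ^ 2 + (z / 2 + y) ^ 2) + Real.sqrt (M ^ 2 + (z / 2 - y) ^ 2)) *
        ENNReal.ofReal (1 / (Real.sqrt (M ^ 2 + (z / 2 + y) ^ 2) *
          Real.sqrt (M ^ 2 + (z / 2 - y) ^ 2))))
  rw [Set.image_univ, (surjective_boost hM z).range_eq, setLIntegral_univ, setLIntegral_univ] at key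
  rw [key]
  refine lintegral_congr fun w => ?_
  rw [abs_of_pos (by positivity), mul_left_comm, ← ENNReal.ofReal_mul (by positivity)]
  congr 1
  · rw [boost_energy hM, boost_energy' hM]; ring_nf
  · congr 1
    field_simp

/-! ### The two-particle collision measure -/

/-- The relativistic energy of a particle of mass `m` and momentum `ξ`. -/
def energy {d : ℕ} (m : ℝ) (ξ : Space d) : ℝ := Real.sqrt (m ^ 2 + ‖ξ‖ ^ 2)

theorem energy_pos {d : ℕ} {m : ℝ} (hm : 0 < m) (ξ : Space d) : 0 < energy m ξ :=
  Real.sqrt_pos.2 (by positivity)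

theorem energy_sq {d : ℕ} (m : ℝ) (ξ : Space d) : energy m ξ ^ 2 = m ^ 2 + ‖ξ‖ ^ 2 :=
  Real.sq_sqrt (by positivity)

@[fun_prop]
theorem continuous_energy {d : ℕ} (m : ℝ) : Continuous (energy m : Space d → ℝ) := by
  unfold energy; fun_prop

theorem norm_le_energy {d : ℕ} (m : ℝ) (ξ : Space d) : ‖ξ‖ ≤ energy m ξ :=
  Real.le_sqrt_of_sq_le (by nlinarith [sq_nonneg m])

/-- Take any isometry and follow it by the reflection that exchanges two vectors of equal norm. This
splits a momentum into its components along ζ and across it. -/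
theorem exists_isometry_axis {n : ℕ} (ζ : Space (n + 1)) :
    ∃ e : SpaceTime n ≃ₗᵢ[ℝ] Space (n + 1), e (WithLp.toLp 2 (‖ζ‖, 0)) = ζ := by
  have hf : Module.finrank ℝ (SpaceTime n) = n + 1 := by
    rw [(WithLp.linearEquiv 2 ℝ (ℝ × Space n)).finrank_eq]
    simp [add_comm]
  let e₀ : SpaceTime n ≃ₗᵢ[ℝ] Space (n + 1) :=
    ((stdOrthonormalBasis ℝ (SpaceTime n)).reindex (finCongr hf)).repr
  have hn : ‖e₀ (WithLp.toLp 2 (‖ζ‖, 0))‖ = ‖ζ‖ := by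
    rw [e₀.norm_map, WithLp.prod_norm_eq_of_L2]
    simp
  refine ⟨e₀.trans (Submodule.reflection (ℝ ∙ (e₀ (WithLp.toLp 2 (‖ζ‖, 0)) - ζ))ᗮ), ?_⟩
  exact Submodule.reflection_sub hn

/-- The component y across ζ is unaffected by the boost and acts as extra mass: for each y, the line
integral applies with M = √(m² + |y|²). The new variable w is the momentum in the rest frame of the
pair. -/
theorem lintegral_energy_sum_aux {n : ℕ} {m : ℝ} (hm : 0 < m) (ζ : Space (n + 1))
    {h : ℝ → ℝ≥0∞} (hh : Measurable h) :
    ∫⁻ ξ : Space (n + 1), h (energy m ξ + energy m (ζ - ξ)) *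
        ENNReal.ofReal (1 / (energy m ξ * energy m (ζ - ξ))) =
      ∫⁻ w : Space (n + 1), h (Real.sqrt (‖ζ‖ ^ 2 + 4 * energy m w ^ 2)) *
        ENNReal.ofReal (2 / (energy m w * Real.sqrt (‖ζ‖ ^ 2 + 4 * energy m w ^ 2))) := by
  obtain ⟨e, he⟩ := exists_isometry_axis ζ
  set z := ‖ζ‖ with hz
  have hE : MeasurePreserving (fun p : ℝ × Space n => e (WithLp.toLp 2 p)) :=
    e.measurePreserving.comp (WithLp.volume_preserving_toLp ℝ (Space n))
  have hemb : MeasurableEmbedding (fun p : ℝ × Space n => e (WithLp.toLp 2 p)) :=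
    e.toMeasurableEquiv.measurableEmbedding.comp (MeasurableEquiv.toLp 2 _).measurableEmbedding
  have hM (y : Space n) : 0 < Real.sqrt (m ^ 2 + ‖y‖ ^ 2) := Real.sqrt_pos.2 (by positivity)
  have hM2 (y : Space n) : Real.sqrt (m ^ 2 + ‖y‖ ^ 2) ^ 2 = m ^ 2 + ‖y‖ ^ 2 :=
    Real.sq_sqrt (by positivity)
  have hen (a : ℝ) (y : Space n) : energy m (e (WithLp.toLp 2 (a, y))) =
      Real.sqrt (Real.sqrt (m ^ 2 + ‖y‖ ^ 2) ^ 2 + a ^ 2) := by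
    unfold energy
    rw [e.norm_map, WithLp.prod_norm_sq_eq_of_L2, hM2]
    simp; ring_nf
  -- Centring at ζ/2 makes the two particles symmetric: their momenta are ζ/2 ± ξ.
  calc _ = ∫⁻ ξ : Space (n + 1), h (energy m ((1/2 : ℝ) • ζ + ξ) + energy m (ζ - ((1/2 : ℝ) • ζ + ξ))) *
        ENNReal.ofReal (1 / (energy m ((1/2 : ℝ) • ζ + ξ) * energy m (ζ - ((1/2 : ℝ) • ζ + ξ)))) :=
        (lintegral_add_left_eq_self (fun ξ => h (energy m ξ + energy m (ζ - ξ)) *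
        ENNReal.ofReal (1 / (energy m ξ * energy m (ζ - ξ)))) _).symm
    _ = ∫⁻ p : ℝ × Space n, h (
          Real.sqrt (Real.sqrt (m ^ 2 + ‖p.2‖ ^ 2) ^ 2 + (z / 2 + p.1) ^ 2) +
          Real.sqrt (Real.sqrt (m ^ 2 + ‖p.2‖ ^ 2) ^ 2 + (z / 2 - p.1) ^ 2)) *
        ENNReal.ofReal (1 / (Real.sqrt (Real.sqrt (m ^ 2 + ‖p.2‖ ^ 2) ^ 2 + (z / 2 + p.1) ^ 2) *
          Real.sqrt (Real.sqrt (m ^ 2 + ‖p.2‖ ^ 2) ^ 2 + (z / 2 - p.1) ^ 2))) := by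
        rw [← hE.lintegral_comp_emb hemb]
        refine lintegral_congr fun p => ?_
        obtain ⟨a, y⟩ := p
        have h1 : (1/2 : ℝ) • ζ + e (WithLp.toLp 2 (a, y)) =
            e (WithLp.toLp 2 (z / 2 + a, y)) := by
          conv_lhs => rw [← he, ← map_smul, ← map_add]
          congr 1
          rw [← WithLp.toLp_smul, ← WithLp.toLp_add]
          congr 1
          ext1 <;> simp; ring
        have h2 : ζ - e (WithLp.toLp 2 (z / 2 + a, y)) =
            e (WithLp.toLp 2 (z / 2 - a, - y)) := by
          conv_lhs => rw [← he, ← map_sub]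
          congr 1
          rw [← WithLp.toLp_sub]
          congr 1
          ext1 <;> simp; ring
        simp only [h1, h2, hen, norm_neg]
    _ = ∫⁻ p : ℝ × Space n, h (Real.sqrt (z ^ 2 + 4 * (Real.sqrt (m ^ 2 + ‖p.2‖ ^ 2) ^ 2 + p.1 ^ 2))) *
        ENNReal.ofReal (2 / (Real.sqrt (Real.sqrt (m ^ 2 + ‖p.2‖ ^ 2) ^ 2 + p.1 ^ 2) *
          Real.sqrt (z ^ 2 + 4 * (Real.sqrt (m ^ 2 + ‖p.2‖ ^ 2) ^ 2 + p.1 ^ 2)))) := by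
        rw [Measure.volume_eq_prod, lintegral_prod_symm _ (by fun_prop),
          lintegral_prod_symm _ (by fun_prop)]
        refine lintegral_congr fun y => ?_
        exact lintegral_energy_line (hM y) z h
    _ = _ := by
        rw [← hE.lintegral_comp_emb hemb]
        refine lintegral_congr fun p => ?_
        obtain ⟨a, y⟩ := p
        simp only [hen]
        rw [Real.sq_sqrt (show 0 ≤ Real.sqrt (m ^ 2 + ‖y‖ ^ 2) ^ 2 + a ^ 2 by positivity)]

/-- Polar coordinates for the lower Lebesgue integral of a radial function. -/
theorem lintegral_fun_norm {E : Type*} [NormedAddCommGroup E] [NormedSpace ℝ E]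
    [FiniteDimensional ℝ E] [MeasurableSpace E] [BorelSpace E] [Nontrivial E]
    (μ : Measure E) [μ.IsAddHaarMeasure] {g : ℝ → ℝ≥0∞} (hg : Measurable g) :
    ∫⁻ x, g ‖x‖ ∂μ = μ.toSphere Set.univ *
      ∫⁻ r in Set.Ioi (0 : ℝ), ENNReal.ofReal (r ^ (Module.finrank ℝ E - 1)) * g r := by
  have h1 := μ.measurePreserving_homeomorphUnitSphereProd.lintegral_comp_emb
    (Homeomorph.measurableEmbedding _) (fun p => g (p.2 : ℝ))
  simp only [homeomorphUnitSphereProd_apply_snd_coe] at h1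
  have h2 : ∫⁻ x, g ‖x‖ ∂μ = ∫⁻ x : ({0}ᶜ : Set E), g ‖x.1‖ ∂(μ.comap (↑)) := by
    rw [lintegral_subtype_comap (measurableSet_singleton _).compl (fun x => g ‖x‖),
      restrict_compl_singleton]
  rw [h2, h1, lintegral_prod _ (by fun_prop)]
  simp only [lintegral_const]
  rw [mul_comm, Measure.volumeIoiPow, lintegral_withDensity_eq_lintegral_mul _ (by fun_prop)
    (by fun_prop)]
  congr 1
  exact lintegral_subtype_comap measurableSet_Ioi
    (fun r => ENNReal.ofReal (r ^ (Module.finrank ℝ E - 1)) * g r)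

/-- The density of the two-particle collision measure: the pushforward of `dξ dη / (ω(ξ) ω(η))`
along `(ξ, η) ↦ (ω(ξ) + ω(η), ξ + η)`. -/
def collisionDensity {d : ℕ} (m : ℝ) (p : SpaceTime d) : ℝ :=
  if Real.sqrt (4 * m ^ 2 + ‖p.snd‖ ^ 2) < p.fst then
    (volume : Measure (Space d)).toSphere.real Set.univ * 2 ^ (2 - (d : ℝ)) *
      (p.fst ^ 2 - ‖p.snd‖ ^ 2 - 4 * m ^ 2) ^ (((d : ℝ) - 2) / 2) /
      Real.sqrt (p.fst ^ 2 - ‖p.snd‖ ^ 2)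
  else 0

theorem collisionDensity_nonneg {d : ℕ} (m : ℝ) (p : SpaceTime d) :
    0 ≤ collisionDensity m p := by
  unfold collisionDensity
  split_ifs with h
  · have h1 := Real.lt_sq_of_sqrt_lt h
    have : 0 ≤ p.fst ^ 2 - ‖p.snd‖ ^ 2 - 4 * m ^ 2 := by linarith
    positivity
  · rfl

@[fun_prop]
theorem measurable_collisionDensity {d : ℕ} (m : ℝ) :
    Measurable (collisionDensity m : SpaceTime d → ℝ) := by
  unfold collisionDensity
  refine Measurable.ite (measurableSet_lt ?_ ?_) ?_ measurable_const
  all_goals fun_prop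

/-- The integrand is radial, so with r = |w| one substitutes τ = T(r), dτ = (4r/τ) dr, which maps r
> 0 onto τ strictly above the threshold √(4m² + |ζ|²). Then r = √(τ² - |ζ|² - 4m²)/2, and r^(d-1)
loses one power of r to the Jacobian; hence the exponent (d-2)/2 and the factor 2^(2-d). -/
theorem lintegral_energy_radial {d : ℕ} (hd : 2 ≤ d) {m : ℝ} (hm : 0 < m) (ζ : Space d)
    {h : ℝ → ℝ≥0∞} (hh : Measurable h) :
    ∫⁻ w : Space d, h (Real.sqrt (‖ζ‖ ^ 2 + 4 * energy m w ^ 2)) *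
        ENNReal.ofReal (2 / (energy m w * Real.sqrt (‖ζ‖ ^ 2 + 4 * energy m w ^ 2))) =
      ∫⁻ τ : ℝ, h τ * ENNReal.ofReal (collisionDensity m (WithLp.toLp 2 (τ, ζ))) := by
  have : Nontrivial (Space d) := by
    have : Nontrivial (Fin d) := Fin.nontrivial_iff_two_le.2 hd
    infer_instance
  set z := ‖ζ‖ with hz
  set E := Real.sqrt (4 * m ^ 2 + z ^ 2) with hE
  set T : ℝ → ℝ := fun r => Real.sqrt (z ^ 2 + 4 * (m ^ 2 + r ^ 2)) with hT
  have hTpos (r : ℝ) : 0 < T r := Real.sqrt_pos.2 (by positivity)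
  have hTsq (r : ℝ) : T r ^ 2 = z ^ 2 + 4 * (m ^ 2 + r ^ 2) := Real.sq_sqrt (by positivity)
  have hTd (r : ℝ) : HasDerivAt T (4 * r / T r) r := by
    have h1 : HasDerivAt (fun r : ℝ => z ^ 2 + 4 * (m ^ 2 + r ^ 2)) (4 * (2 * r)) r := by
      have := ((((hasDerivAt_pow 2 r).const_add (m ^ 2)).const_mul 4)).const_add (z ^ 2)
      simpa using this
    refine (h1.sqrt (by positivity)).congr_deriv ?_
    rw [hT]; field_simp
  have hinj : Set.InjOn T (Set.Ioi 0) := by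
    intro a ha b hb hab
    have h1 := hTsq a
    rw [hab, hTsq b] at h1
    have ha' : (0 : ℝ) < a := ha
    have hb' : (0 : ℝ) < b := hb
    nlinarith [sq_nonneg (a - b)]
  have himg : T '' Set.Ioi 0 = Set.Ioi E := by
    ext τ
    constructor
    · rintro ⟨r, hr, rfl⟩
      refine Real.sqrt_lt_sqrt (by positivity) ?_
      have : (0 : ℝ) < r ^ 2 := by have : (0 : ℝ) < r := hr; positivity
      linarith
    · intro hτ
      have h1 : E < τ := hτ
      have h0 : 0 < τ := (Real.sqrt_nonneg _).trans_lt h1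
      have h2 := Real.lt_sq_of_sqrt_lt h1
      have h3 : 0 < (τ ^ 2 - z ^ 2) / 4 - m ^ 2 := by linarith
      refine ⟨Real.sqrt ((τ ^ 2 - z ^ 2) / 4 - m ^ 2), Real.sqrt_pos.2 h3, ?_⟩
      rw [hT]
      simp only
      rw [Real.sq_sqrt h3.le, show z ^ 2 + 4 * (m ^ 2 + ((τ ^ 2 - z ^ 2) / 4 - m ^ 2)) = τ ^ 2 by ring,
        Real.sqrt_sq h0.le]
  have hR : ∫⁻ τ : ℝ, h τ * ENNReal.ofReal (collisionDensity m (WithLp.toLp 2 (τ, ζ))) =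
      ∫⁻ τ in T '' Set.Ioi 0,
        h τ * ENNReal.ofReal (collisionDensity m (WithLp.toLp 2 (τ, ζ))) := by
    rw [himg, ← lintegral_indicator measurableSet_Ioi]
    refine lintegral_congr fun τ => ?_
    by_cases hτ : τ ∈ Set.Ioi E
    · rw [Set.indicator_of_mem hτ]
    · rw [Set.indicator_of_notMem hτ, collisionDensity, if_neg, ENNReal.ofReal_zero, mul_zero]
      exact hτ
  rw [hR, lintegral_image_eq_lintegral_abs_deriv_mul measurableSet_Ioi
    (fun r _ => (hTd r).hasDerivWithinAt) hinj]
  have hL := lintegral_fun_norm (volume : Measure (Space d))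
    (g := fun r => h (T r) * ENNReal.ofReal (2 / (Real.sqrt (m ^ 2 + r ^ 2) * T r)))
    (by fun_prop)
  have hσ : (volume : Measure (Space d)).toSphere Set.univ ≠ ∞ := measure_ne_top _ _
  calc _ = ∫⁻ w : Space d, h (T ‖w‖) * ENNReal.ofReal (2 / (Real.sqrt (m ^ 2 + ‖w‖ ^ 2) * T ‖w‖)) := by
        simp only [energy_sq]; rfl
    _ = _ := by
      rw [hL, ← lintegral_const_mul' _ _ hσ]
      refine setLIntegral_congr_fun measurableSet_Ioi fun r hr => ?_
      have hr' : (0 : ℝ) < r := hr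
      have hc : E < T r := by
        have : T r ∈ T '' Set.Ioi 0 := Set.mem_image_of_mem _ hr
        rwa [himg] at this
      rw [collisionDensity, if_pos (by simpa using hc), abs_of_pos (by have := hTpos r; positivity),
        ← ENNReal.ofReal_toReal hσ]
      have hre (a b c e : ℝ≥0∞) : a * (b * (c * e)) = c * (a * b * e) := by ring
      have hTr := hTpos r
      rw [hre, mul_left_comm (ENNReal.ofReal (4 * r / T r)), ← ENNReal.ofReal_mul (by positivity),
        ← ENNReal.ofReal_mul (by positivity), ← ENNReal.ofReal_mul (by positivity)]
      congr 2
      simp only [finrank_euclideanSpace, Fintype.card_fin, WithLp.toLp_fst, WithLp.toLp_snd, ← hz,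
        hTsq]
      have hν : 0 < Real.sqrt (m ^ 2 + r ^ 2) := Real.sqrt_pos.2 (by positivity)
      have e1 : z ^ 2 + 4 * (m ^ 2 + r ^ 2) - z ^ 2 - 4 * m ^ 2 = (2 * r) ^ 2 := by ring
      have e2 : Real.sqrt (z ^ 2 + 4 * (m ^ 2 + r ^ 2) - z ^ 2) = 2 * Real.sqrt (m ^ 2 + r ^ 2) := by
        rw [show z ^ 2 + 4 * (m ^ 2 + r ^ 2) - z ^ 2 = 2 ^ 2 * (m ^ 2 + r ^ 2) by ring,
          Real.sqrt_mul (by positivity), Real.sqrt_sq (by norm_num)]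
      have e3 : ((2 * r) ^ 2) ^ (((d : ℝ) - 2) / 2) = 2 ^ ((d : ℝ) - 2) * r ^ (d - 2) := by
        rw [← Real.rpow_natCast (2 * r) 2, ← Real.rpow_mul (by positivity),
          Real.mul_rpow (by norm_num) hr'.le]
        rw [← Real.rpow_natCast r (d - 2), Nat.cast_sub hd]
        congr 2 <;> push_cast <;> ring
      have e4 : (2 : ℝ) ^ (2 - (d : ℝ)) * 2 ^ ((d : ℝ) - 2) = 1 := by
        rw [← Real.rpow_add (by norm_num)]; simp
      have e5 : r ^ (d - 1) = r ^ (d - 2) * r := by rw [← pow_succ]; congr 1; omega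
      rw [e1, e2, e3, e5, Measure.real]
      field_simp
      linear_combination
        (-4 * ((volume : Measure (Space d)).toSphere Set.univ).toReal) * e4

/-- The two-particle momentum map `(ξ, η) ↦ (ω(ξ) + ω(η), ξ + η)`. -/
def momentum {d : ℕ} (m : ℝ) (x : Space d × Space d) : SpaceTime d :=
  WithLp.toLp 2 (energy m x.1 + energy m x.2, x.1 + x.2)

@[fun_prop]
theorem continuous_momentum {d : ℕ} (m : ℝ) :
    Continuous (momentum m : Space d × Space d → SpaceTime d) := by
  unfold momentum
  fun_prop

theorem lintegral_momentum {d : ℕ} (hd : 2 ≤ d) {m : ℝ} (hm : 0 < m)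
    {h : SpaceTime d → ℝ≥0∞} (hh : Measurable h) :
    ∫⁻ x : Space d × Space d, h (momentum m x) *
        ENNReal.ofReal (1 / (energy m x.1 * energy m x.2)) =
      ∫⁻ p, h p * ENNReal.ofReal (collisionDensity m p) := by
  obtain ⟨n, rfl⟩ : ∃ n, d = n + 1 := ⟨d - 1, by omega⟩
  calc _ = ∫⁻ ξ : Space (n + 1), ∫⁻ η : Space (n + 1), h (momentum m (ξ, η)) *
        ENNReal.ofReal (1 / (energy m ξ * energy m η)) := by
        rw [Measure.volume_eq_prod, lintegral_prod _ (by fun_prop)]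
    _ = ∫⁻ ξ : Space (n + 1), ∫⁻ ζ : Space (n + 1), h (momentum m (ξ, ζ - ξ)) *
        ENNReal.ofReal (1 / (energy m ξ * energy m (ζ - ξ))) := by
        refine lintegral_congr fun ξ => ?_
        exact (lintegral_sub_right_eq_self (fun η => h (momentum m (ξ, η)) *
          ENNReal.ofReal (1 / (energy m ξ * energy m η))) ξ).symm
    _ = ∫⁻ ζ : Space (n + 1), ∫⁻ ξ : Space (n + 1),
        h (WithLp.toLp 2 (energy m ξ + energy m (ζ - ξ), ζ)) *
        ENNReal.ofReal (1 / (energy m ξ * energy m (ζ - ξ))) := by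
        rw [lintegral_lintegral_swap (by fun_prop)]
        simp [momentum]
    _ = ∫⁻ ζ : Space (n + 1), ∫⁻ τ : ℝ, h (WithLp.toLp 2 (τ, ζ)) *
        ENNReal.ofReal (collisionDensity m (WithLp.toLp 2 (τ, ζ))) := by
        refine lintegral_congr fun ζ => ?_
        have hm' : Measurable fun τ : ℝ => h (WithLp.toLp 2 (τ, ζ)) := by fun_prop
        rw [lintegral_energy_sum_aux hm ζ hm', lintegral_energy_radial hd hm ζ hm']
    _ = _ := by
        rw [← (WithLp.volume_preserving_toLp ℝ (Space (n + 1))).lintegral_comp_emb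
          (MeasurableEquiv.toLp 2 _).measurableEmbedding, Measure.volume_eq_prod,
          lintegral_prod_symm _ (by fun_prop)]

/-! ### Fourier integrals on L¹ ∩ L² and limits of bilinear pairings -/

section FourierL1L2
variable {E : Type*} [NormedAddCommGroup E] [InnerProductSpace ℝ E] [FiniteDimensional ℝ E]
  [MeasurableSpace E] [BorelSpace E]

/-- On `L¹ ∩ L²` the inverse Fourier transform of `L²` is given by the Fourier integral. -/
theorem fourierInv_toLp_ae_eq {h : E → ℂ} (h1 : Integrable h) (h2 : MemLp h 2) :
    (𝓕⁻ (h2.toLp h) : Lp (α := E) ℂ 2) =ᵐ[volume] (𝓕⁻ h : E → ℂ) := by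
  have hL : Continuous fun p : E × E => (-innerₗ E) p.1 p.2 := by
    simp only [LinearMap.neg_apply, innerₗ_apply_apply]
    fun_prop
  have hc : Continuous (𝓕⁻ h : E → ℂ) :=
    VectorFourier.fourierIntegral_continuous Real.continuous_fourierChar hL h1
  refine ae_eq_of_integral_contDiff_smul_eq ((Lp.memLp _).locallyIntegrable (by norm_num))
    hc.locallyIntegrable fun g hg hgs => ?_
  have hg₁ : HasCompactSupport (Complex.ofRealCLM ∘ g) := hgs.comp_left rfl
  have hg₂ : ContDiff ℝ (⊤ : ℕ∞) (Complex.ofRealCLM ∘ g) := by fun_prop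
  set φ : 𝓢(E, ℂ) := hg₁.toSchwartzMap hg₂ with hφ
  have hφg (x : E) : φ x = (g x : ℂ) := rfl
  set L : Lp ℂ 2 (volume : Measure E) := h2.toLp h with hLdef
  set L' : Lp ℂ 2 (volume : Measure E) := 𝓕⁻ L with hLdef'
  calc ∫ x, g x • L' x
      = ∫ x, φ x • L' x := by simp [hφg]
    _ = Lp.toTemperedDistribution L' φ := by rw [Lp.toTemperedDistribution_apply]
    _ = Lp.toTemperedDistribution L (𝓕⁻ φ) := by
      rw [hLdef', ← Lp.fourierInv_toTemperedDistribution_eq, TemperedDistribution.fourierInv_apply]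
    _ = ∫ x, (𝓕⁻ φ : 𝓢(E, ℂ)) x * h x := by
      rw [Lp.toTemperedDistribution_apply]
      refine integral_congr_ae ?_
      filter_upwards [h2.coeFn_toLp] with x hx
      rw [hx, smul_eq_mul]
    _ = ∫ x, (𝓕⁻ (φ : E → ℂ) : E → ℂ) x * h x := by
      simp only [SchwartzMap.fourierInv_coe]
    _ = ∫ x, φ x * (𝓕⁻ h : E → ℂ) x := by
      have := VectorFourier.integral_bilin_fourierIntegral_eq_flip (ContinuousLinearMap.mul ℂ ℂ)
        Real.continuous_fourierChar hL (φ.integrable (μ := volume)) h1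
      simp only [ContinuousLinearMap.mul_apply'] at this
      refine this.trans (integral_congr_ae (Filter.Eventually.of_forall fun x => ?_))
      simp only
      congr 1
      simp only [VectorFourier.fourierIntegral, FourierTransformInv.fourierInv,
        LinearMap.neg_apply, LinearMap.flip_apply, innerₗ_apply_apply, real_inner_comm]
    _ = _ := by simp [hφg]
end FourierL1L2

/-- The integral of a product of two `L²` functions against a bounded function. -/
theorem norm_integral_mul_mul_le {α : Type*} [MeasurableSpace α] {μ : Measure α}
    (u v : Lp ℂ 2 μ) {k : α → ℂ} {B : ℝ} (hB : ∀ x, ‖k x‖ ≤ B) :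
    ‖∫ x, u x * v x * k x ∂μ‖ ≤ B * (‖u‖ * ‖v‖) := by
  have hint : Integrable (fun x => u x * v x) μ := (Lp.memLp u).integrable_mul (Lp.memLp v)
  set w : Lp ℂ 1 μ := (ContinuousLinearMap.mul ℂ ℂ).holder 1 u v with hw
  have hwe : w =ᵐ[μ] fun x => u x * v x := (ContinuousLinearMap.mul ℂ ℂ).coeFn_holder u v
  have hwn : ‖w‖ ≤ ‖u‖ * ‖v‖ := by
    have h1 := (ContinuousLinearMap.mul ℂ ℂ).norm_holder_apply_apply_le (r := 1) u v
    have h2 := ContinuousLinearMap.opNorm_mul_le ℂ ℂ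
    calc ‖w‖ ≤ _ := h1
      _ ≤ 1 * ‖u‖ * ‖v‖ := by gcongr
      _ = _ := by ring
  have hw1 : ‖w‖ = ∫ x, ‖u x * v x‖ ∂μ := by
    rw [L1.norm_eq_integral_norm]
    refine integral_congr_ae ?_
    filter_upwards [hwe] with x hx
    rw [hx]
  -- The sign of B is read off at a point of the space; on an empty space both sides vanish.
  by_cases hne : Nonempty α
  · obtain ⟨x₀⟩ := hne
    have hB0 : 0 ≤ B := (norm_nonneg _).trans (hB x₀)
    calc ‖∫ x, u x * v x * k x ∂μ‖ ≤ ∫ x, ‖u x * v x‖ * B ∂μ := by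
          refine norm_integral_le_of_norm_le (hint.norm.mul_const B) ?_
          refine Filter.Eventually.of_forall fun x => ?_
          rw [norm_mul (u x * v x)]
          gcongr
          exact hB x
      _ = B * ‖w‖ := by rw [integral_mul_const, hw1, mul_comm]
      _ ≤ _ := by gcongr
  · have : IsEmpty α := not_nonempty_iff.1 hne
    have hμ : μ = 0 := Measure.eq_zero_of_isEmpty μ
    have hu : ‖u‖ = 0 := by subst hμ; simp [Lp.norm_def]
    subst hμ
    simp [hu]

/-- Telescoping, uv - u₀v₀ = (u - u₀)v + u₀(v - v₀), with the L²-L² bound on each term. -/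
theorem tendsto_integral_mul_mul {α ι : Type*} [MeasurableSpace α] {μ : Measure α}
    {l : Filter ι} {u : ι → Lp ℂ 2 μ} {v : ι → Lp ℂ 2 μ} {u₀ v₀ : Lp ℂ 2 μ}
    (hu : Filter.Tendsto u l (nhds u₀)) (hv : Filter.Tendsto v l (nhds v₀))
    {k : α → ℂ} {B : ℝ} (hk : AEStronglyMeasurable k μ) (hB : ∀ x, ‖k x‖ ≤ B) :
    Filter.Tendsto (fun i => ∫ x, u i x * v i x * k x ∂μ) l
      (nhds (∫ x, u₀ x * v₀ x * k x ∂μ)) := by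
  have hkey (a b : Lp ℂ 2 μ) : Integrable (fun x => a x * b x * k x) μ :=
    ((Lp.memLp a).integrable_mul (Lp.memLp b)).mul_bdd hk (Filter.Eventually.of_forall hB)
  have hdiff (a b : Lp ℂ 2 μ) : ∫ x, a x * b x * k x ∂μ - ∫ x, u₀ x * v₀ x * k x ∂μ =
      ∫ x, (a - u₀) x * b x * k x ∂μ + ∫ x, u₀ x * (b - v₀) x * k x ∂μ := by
    rw [← integral_sub (hkey _ _) (hkey _ _), ← integral_add (hkey _ _) (hkey _ _)]
    refine integral_congr_ae ?_
    filter_upwards [Lp.coeFn_sub a u₀, Lp.coeFn_sub b v₀] with x h1 h2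
    rw [h1, h2, Pi.sub_apply, Pi.sub_apply]
    ring
  rw [tendsto_iff_norm_sub_tendsto_zero]
  have hu' := tendsto_iff_norm_sub_tendsto_zero.1 hu
  have hv' := tendsto_iff_norm_sub_tendsto_zero.1 hv
  have hlim : Filter.Tendsto (fun i => B * (‖u i - u₀‖ * ‖v i‖) + B * (‖u₀‖ * ‖v i - v₀‖)) l
      (nhds 0) := by
    simpa using ((hu'.mul hv.norm).const_mul B).add ((hv'.const_mul ‖u₀‖).const_mul B)
  refine squeeze_zero (fun _ => norm_nonneg _) (fun i => ?_) hlim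
  rw [hdiff]
  exact (norm_add_le _ _).trans
    (add_le_add (norm_integral_mul_mul_le _ _ hB) (norm_integral_mul_mul_le _ _ hB))

/-! ### The propagator and the space-time Fourier transform of a product -/

theorem phi_two_pi {d : ℕ} (s : ℝ) (ξ : Space d) :
    phi s (2 * Real.pi * ‖ξ‖) = 2 * Real.pi * energy (s / (2 * Real.pi)) ξ := by
  have hp : (0 : ℝ) < 2 * Real.pi := by positivity
  unfold phi energy
  rw [Real.sqrt_eq_iff_mul_self_eq (by positivity) (by positivity), ← pow_two,
    mul_pow (2 * Real.pi) (Real.sqrt _), Real.sq_sqrt (by positivity)]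
  field_simp

theorem fourierInv_sub_L2 {d : ℕ} (u v : L2 d) : 𝓕⁻ (u - v) = 𝓕⁻ u - 𝓕⁻ v :=
  (Lp.fourierTransformₗᵢ (Space d) ℂ).symm.map_sub u v

theorem fourier_sub_L2 {d : ℕ} (u v : L2 d) : 𝓕 (u - v) = 𝓕 u - 𝓕 v :=
  (Lp.fourierTransformₗᵢ (Space d) ℂ).map_sub u v

theorem norm_fourierInv_L2 {d : ℕ} (u : L2 d) : ‖𝓕⁻ u‖ = ‖u‖ :=
  (Lp.fourierTransformₗᵢ (Space d) ℂ).symm.norm_map u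

/-- The multiplier is unimodular. Stated for distances, the result gives continuity in the data,
which lets truncations pass to the limit. -/
theorem isometry_propagator {d : ℕ} (s t : ℝ) : Isometry (propagator s t : L2 d → L2 d) := by
  refine Isometry.of_dist_eq fun f g => ?_
  rw [dist_eq_norm, dist_eq_norm]
  unfold propagator
  rw [← fourierInv_sub_L2, norm_fourierInv_L2, ← Lp.norm_fourier_eq (f - g), fourier_sub_L2,
    ← MemLp.toLp_sub]
  have h : ∀ᵐ ξ, ‖(((memLp_phase_mul s t (𝓕 f : L2 d)).sub
      (memLp_phase_mul s t (𝓕 g : L2 d))).toLp _ : L2 d) ξ‖ = ‖(𝓕 f - 𝓕 g : L2 d) ξ‖ := by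
    filter_upwards [((memLp_phase_mul s t (𝓕 f : L2 d)).sub
      (memLp_phase_mul s t (𝓕 g : L2 d))).coeFn_toLp, Lp.coeFn_sub (𝓕 f : L2 d) (𝓕 g)]
      with ξ h1 h2
    rw [h1, h2, Pi.sub_apply, Pi.sub_apply, ← mul_sub, norm_mul, Complex.norm_exp_ofReal_mul_I,
      one_mul]
  exact le_antisymm (Lp.norm_le_norm_of_ae_le (h.mono fun _ h => h.le))
    (Lp.norm_le_norm_of_ae_le (h.mono fun _ h => h.ge))

theorem norm_propagator {d : ℕ} (s t : ℝ) (f : L2 d) : ‖propagator s t f‖ = ‖f‖ := by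
  unfold propagator
  rw [norm_fourierInv_L2, ← Lp.norm_fourier_eq f]
  have h : ∀ᵐ ξ, ‖((memLp_phase_mul s t (𝓕 f : L2 d)).toLp _ : L2 d) ξ‖ = ‖(𝓕 f : L2 d) ξ‖ := by
    filter_upwards [(memLp_phase_mul s t (𝓕 f : L2 d)).coeFn_toLp] with ξ h1
    rw [h1, norm_mul, Complex.norm_exp_ofReal_mul_I, one_mul]
  exact le_antisymm (Lp.norm_le_norm_of_ae_le (h.mono fun _ h => h.le))
    (Lp.norm_le_norm_of_ae_le (h.mono fun _ h => h.ge))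

/-- The wave with frequency profile `F`, as an absolutely convergent integral. -/
def wave {d : ℕ} (m : ℝ) (F : Space d → ℂ) (t : ℝ) (x : Space d) : ℂ :=
  ∫ ξ, Complex.exp (((2 * Real.pi * (t * energy m ξ + inner ℝ ξ x) : ℝ) : ℂ) * Complex.I) * F ξ

theorem propagator_ae_eq_wave {d : ℕ} (s t : ℝ) {F : Space d → ℂ} (h1 : Integrable F)
    (h2 : MemLp F 2) :
    propagator s t (𝓕⁻ (h2.toLp F) : L2 d) =ᵐ[volume] wave (s / (2 * Real.pi)) F t := by
  set P : Space d → ℂ := fun ξ =>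
    Complex.exp (((t * phi s (2 * Real.pi * ‖ξ‖) : ℝ) : ℂ) * Complex.I) * F ξ with hP
  have hc : Continuous (fun ξ : Space d =>
      Complex.exp (((t * phi s (2 * Real.pi * ‖ξ‖) : ℝ) : ℂ) * Complex.I)) := by
    unfold phi
    fun_prop
  have hP1 : Integrable P := by
    refine h1.mono (hc.aestronglyMeasurable.mul h1.1) (Filter.Eventually.of_forall fun ξ => ?_)
    rw [hP]
    simp only [norm_mul, Complex.norm_exp_ofReal_mul_I, one_mul, le_refl]
  have hae : (fun ξ : Space d => Complex.exp (((t * phi s (2 * Real.pi * ‖ξ‖) : ℝ) : ℂ) *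
      Complex.I) * (𝓕 (𝓕⁻ (h2.toLp F) : L2 d) : L2 d) ξ) =ᵐ[volume] P := by
    rw [FourierTransform.fourier_fourierInv_eq]
    filter_upwards [h2.coeFn_toLp] with ξ hξ
    rw [hξ]
  have hP2 : MemLp P 2 := (memLp_phase_mul s t _).ae_eq hae
  have hpr : propagator s t (𝓕⁻ (h2.toLp F) : L2 d) = 𝓕⁻ (hP2.toLp P) := by
    unfold propagator
    congr 1
    exact MemLp.toLp_congr _ _ hae
  rw [hpr]
  refine (fourierInv_toLp_ae_eq hP1 hP2).trans (Filter.Eventually.of_forall fun x => ?_)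
  rw [Real.fourierInv_eq', wave]
  refine integral_congr_ae (Filter.Eventually.of_forall fun ξ => ?_)
  simp only [hP, phi_two_pi, smul_eq_mul]
  rw [← mul_assoc, ← Complex.exp_add]
  congr 2
  push_cast
  ring

/-- The phases add, so the product oscillates at the total energy and momentum of the pair. -/
theorem wave_mul_wave {d : ℕ} (m : ℝ) (F G : Space d → ℂ) (t : ℝ) (x : Space d) :
    wave m F t x * wave m G t x = ∫ z : Space d × Space d,
      (Real.fourierChar (inner ℝ (momentum m z) (WithLp.toLp 2 (t, x) : SpaceTime d)) : ℂ) *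
        (F z.1 * G z.2) := by
  unfold wave
  rw [← integral_prod_mul, ← Measure.volume_eq_prod]
  refine integral_congr_ae (Filter.Eventually.of_forall fun z => ?_)
  simp only [Real.fourierChar_apply, WithLp.prod_inner_apply, momentum]
  rw [mul_mul_mul_comm, ← Complex.exp_add]
  congr 2
  rw [← add_mul, ← Complex.ofReal_add]
  congr 2
  simp only [inner_add_left, RCLike.inner_apply, conj_trivial]
  ring

section
variable {d : ℕ} (m : ℝ) {F G : Space d → ℂ}
  (k : 𝓢(SpaceTime d, ℂ))

theorem integrable_wave_pairing (hF : Integrable F) (hG : Integrable G) :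
    Integrable (fun q : SpaceTime d × (Space d × Space d) =>
      (Real.fourierChar (inner ℝ (momentum m q.2) q.1) : ℂ) * (F q.2.1 * G q.2.2) * k q.1)
      (volume.prod volume) := by
  have h1 : Integrable (fun z : Space d × Space d => F z.1 * G z.2) := by
    rw [Measure.volume_eq_prod]; exact hF.mul_prod hG
  have h2 : Integrable (fun q : SpaceTime d × (Space d × Space d) =>
      k q.1 * (F q.2.1 * G q.2.2)) (volume.prod volume) := (k.integrable (μ := volume)).mul_prod h1
  have hc : Continuous fun q : SpaceTime d × (Space d × Space d) =>
      (Real.fourierChar (inner ℝ (momentum m q.2) q.1) : ℂ) := by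
    have := Real.continuous_fourierChar
    fun_prop
  refine (h2.bdd_mul (c := 1) hc.aestronglyMeasurable
    (Filter.Eventually.of_forall fun q => (Circle.norm_coe _).le)).congr
    (Filter.Eventually.of_forall fun q => ?_)
  simp only
  ring

theorem integrable_wave_mul_wave (hF : Integrable F) (hG : Integrable G) :
    Integrable (fun p : ℝ × Space d =>
      wave m F p.1 p.2 * wave m G p.1 p.2 * k (WithLp.toLp 2 p)) := by
  have h := (integrable_wave_pairing m k hF hG).integral_prod_left
  have h' := ((WithLp.volume_preserving_toLp ℝ (Space d)).integrable_comp_emb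
    (MeasurableEquiv.toLp 2 _).measurableEmbedding).2 h
  refine h'.congr (Filter.Eventually.of_forall fun p => ?_)
  simp only [Function.comp_apply]
  rw [wave_mul_wave, ← integral_mul_const]

/-- Integrable profiles and a Schwartz weight make Fubini legitimate; the integral in (t, x) comes
first. -/
theorem integral_wave_mul_wave (hF : Integrable F) (hG : Integrable G) :
    ∫ t : ℝ, ∫ x : Space d, wave m F t x * wave m G t x * k (WithLp.toLp 2 (t, x)) =
      ∫ z : Space d × Space d, F z.1 * G z.2 * (𝓕⁻ k : 𝓢(SpaceTime d, ℂ)) (momentum m z) := by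
  have h0 := integrable_wave_mul_wave m k hF hG
  rw [Measure.volume_eq_prod] at h0
  calc _ = ∫ p : ℝ × Space d, wave m F p.1 p.2 * wave m G p.1 p.2 * k (WithLp.toLp 2 p) := by
        rw [Measure.volume_eq_prod, integral_prod _ h0]
    _ = ∫ p : SpaceTime d, ∫ z : Space d × Space d,
        (Real.fourierChar (inner ℝ (momentum m z) p) : ℂ) * (F z.1 * G z.2) * k p := by
        rw [← (WithLp.volume_preserving_toLp ℝ (Space d)).integral_comp
          (MeasurableEquiv.toLp 2 _).measurableEmbedding]
        refine integral_congr_ae (Filter.Eventually.of_forall fun p => ?_)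
        simp only
        rw [wave_mul_wave, ← integral_mul_const]
    _ = ∫ z : Space d × Space d, ∫ p : SpaceTime d,
        (Real.fourierChar (inner ℝ (momentum m z) p) : ℂ) * (F z.1 * G z.2) * k p :=
        integral_integral_swap (integrable_wave_pairing m k hF hG)
    _ = _ := by
        refine integral_congr_ae (Filter.Eventually.of_forall fun z => ?_)
        simp only [SchwartzMap.fourierInv_coe, Real.fourierInv_eq]
        rw [← integral_const_mul]
        refine integral_congr_ae (Filter.Eventually.of_forall fun p => ?_)
        simp only [Circle.smul_def, smul_eq_mul]
        rw [real_inner_comm]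
        ring
end

/-- Decay in t alone suffices: on each time slice the product of waves is bounded in L¹ uniformly in
t, by conservation of the L² norm. -/
theorem exists_bound_schwartz_spaceTime {d : ℕ} (k : 𝓢(SpaceTime d, ℂ)) :
    ∃ C : ℝ, 0 ≤ C ∧ ∀ (t : ℝ) (x : Space d), ‖k (WithLp.toLp 2 (t, x))‖ ≤ C * (1 + t ^ 2)⁻¹ := by
  obtain ⟨C₀, h0p, h0⟩ := k.decay 0 0
  obtain ⟨C₂, h2p, h2⟩ := k.decay 2 0
  refine ⟨C₀ + C₂, by positivity, fun t x => ?_⟩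
  have a0 := h0 (WithLp.toLp 2 (t, x))
  have a2 := h2 (WithLp.toLp 2 (t, x))
  simp only [norm_iteratedFDeriv_zero, pow_zero, one_mul] at a0 a2
  have hn : t ^ 2 ≤ ‖(WithLp.toLp 2 (t, x) : SpaceTime d)‖ ^ 2 := by
    rw [WithLp.prod_norm_sq_eq_of_L2]
    simp
  rw [← div_eq_mul_inv, le_div_iff₀ (by positivity)]
  have := mul_le_mul_of_nonneg_right hn (norm_nonneg (k (WithLp.toLp 2 (t, x))))
  nlinarith

/-- The frequency truncation of an `L²` function. -/
theorem memLp_truncate {d : ℕ} (F : L2 d) (n : ℕ) :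
    MemLp ((Metric.closedBall (0 : Space d) n).indicator F) 2 :=
  (Lp.memLp F).indicator Metric.isClosed_closedBall.measurableSet

theorem integrable_truncate {d : ℕ} (F : L2 d) (n : ℕ) :
    Integrable ((Metric.closedBall (0 : Space d) n).indicator F) := by
  rw [integrable_indicator_iff Metric.isClosed_closedBall.measurableSet]
  have : IsFiniteMeasure (volume.restrict (Metric.closedBall (0 : Space d) n)) :=
    ⟨by simpa using measure_closedBall_lt_top⟩
  exact ((Lp.memLp F).restrict _).integrable (by norm_num)

theorem tendsto_truncate {d : ℕ} (F : L2 d) :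
    Filter.Tendsto (fun n : ℕ => (memLp_truncate F n).toLp _) Filter.atTop (nhds F) := by
  have h := (Lp.tendsto_Lp_iff_tendsto_eLpNorm'' (fi := Filter.atTop)
    (fun n : ℕ => (Metric.closedBall (0 : Space d) n).indicator F) (memLp_truncate F) F
    (Lp.memLp F)).2 ?_
  · rwa [Lp.toLp_coeFn] at h
  have h2 : ∫⁻ ξ, ‖F ξ‖ₑ ^ (2 : ℝ) ≠ ∞ := by
    have := (Lp.memLp F).2
    have h := lintegral_rpow_enorm_lt_top_of_eLpNorm_lt_top (by norm_num) (by norm_num) this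
    simpa using h.ne
  have hl : Filter.Tendsto (fun n : ℕ => ∫⁻ ξ,
      ‖((Metric.closedBall (0 : Space d) n).indicator F - (F : Space d → ℂ)) ξ‖ₑ ^ (2 : ℝ))
      Filter.atTop (nhds (∫⁻ _ : Space d, 0)) := by
    refine tendsto_lintegral_of_dominated_convergence' (fun ξ => ‖F ξ‖ₑ ^ (2 : ℝ)) (fun n => ?_)
      (fun n => Filter.Eventually.of_forall fun ξ => ?_) h2 (Filter.Eventually.of_forall fun ξ => ?_)
    · exact (((memLp_truncate F n).sub (Lp.memLp F)).1.enorm).pow_const _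
    · by_cases hξ : ξ ∈ Metric.closedBall (0 : Space d) n
      · simp [hξ]
      · simp [hξ]
    · refine tendsto_const_nhds.congr' ?_
      obtain ⟨N, hN⟩ := exists_nat_ge ‖ξ‖
      filter_upwards [Filter.eventually_ge_atTop N] with n hn
      have hξ : ξ ∈ Metric.closedBall (0 : Space d) n := by
        rw [mem_closedBall_zero_iff]
        exact hN.trans (by exact_mod_cast hn)
      simp [hξ]
  have := (hl.ennrpow_const (1 / 2))
  simp only [lintegral_zero] at this
  simpa [eLpNorm_eq_lintegral_rpow_enorm_toReal] using this

/-- Both energies enter with the same sign and dominate the momenta, so preimages of bounded sets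
are bounded. -/
theorem mem_closedBall_of_norm_momentum_le {d : ℕ} {m R : ℝ} {z : Space d × Space d}
    (h : ‖momentum m z‖ ≤ R) :
    z.1 ∈ Metric.closedBall (0 : Space d) R ∧ z.2 ∈ Metric.closedBall (0 : Space d) R := by
  have h1 : ‖(momentum m z).fst‖ ≤ ‖momentum m z‖ := WithLp.norm_fst_le _ _
  have h2 : energy m z.1 + energy m z.2 ≤ R := (le_abs_self _).trans (h1.trans h)
  have e1 := norm_le_energy m z.1
  have e2 := norm_le_energy m z.2
  have e3 := norm_nonneg z.1
  have e4 := norm_nonneg z.2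
  constructor <;> rw [mem_closedBall_zero_iff] <;> linarith

/-- The space-time Fourier transform of the product of two Klein-Gordon waves. -/
theorem integral_productPP {d : ℕ} (s : ℝ) (f g : L2 d) (ψ : 𝓢(SpaceTime d, ℂ))
    (hψ : HasCompactSupport ψ) :
    ∫ t : ℝ, ∫ x : Space d,
        productPP s f g t x * (𝓕 ψ : 𝓢(SpaceTime d, ℂ)) (WithLp.toLp 2 (t, x)) =
      ∫ z : Space d × Space d, (𝓕 f : L2 d) z.1 * (𝓕 g : L2 d) z.2 *
        ψ (momentum (s / (2 * Real.pi)) z) := by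
  set m := s / (2 * Real.pi) with hm
  set F : L2 d := 𝓕 f with hF
  set G : L2 d := 𝓕 g with hG
  set k : 𝓢(SpaceTime d, ℂ) := 𝓕 ψ with hk
  set fn : ℕ → L2 d := fun n => 𝓕⁻ ((memLp_truncate F n).toLp _) with hfn
  set gn : ℕ → L2 d := fun n => 𝓕⁻ ((memLp_truncate G n).toLp _) with hgn
  have hinv (u : ℕ → L2 d) (v : L2 d) (h : Filter.Tendsto u Filter.atTop (nhds (𝓕 v))) :
      Filter.Tendsto (fun n => (𝓕⁻ (u n) : L2 d)) Filter.atTop (nhds v) := by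
    have := ((Lp.fourierTransformₗᵢ (Space d) ℂ).symm.continuous.tendsto (𝓕 v)).comp h
    rwa [show (Lp.fourierTransformₗᵢ (Space d) ℂ).symm (𝓕 v) = v from
      (Lp.fourierTransformₗᵢ (Space d) ℂ).symm_apply_apply v] at this
  have hft : Filter.Tendsto fn Filter.atTop (nhds f) := hinv _ _ (tendsto_truncate F)
  have hgt : Filter.Tendsto gn Filter.atTop (nhds g) := hinv _ _ (tendsto_truncate G)
  obtain ⟨C, hC0, hC⟩ := exists_bound_schwartz_spaceTime k
  have hslice (t : ℝ) : Continuous fun x : Space d => k (WithLp.toLp 2 (t, x)) := by fun_prop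
  have hae (n : ℕ) (t : ℝ) : ∫ x : Space d, productPP s (fn n) (gn n) t x * k (WithLp.toLp 2 (t, x)) =
      ∫ x : Space d, wave m ((Metric.closedBall (0 : Space d) n).indicator F) t x *
        wave m ((Metric.closedBall (0 : Space d) n).indicator G) t x *
        k (WithLp.toLp 2 (t, x)) := by
    refine integral_congr_ae ?_
    filter_upwards [propagator_ae_eq_wave s t (integrable_truncate F n) (memLp_truncate F n),
      propagator_ae_eq_wave s t (integrable_truncate G n) (memLp_truncate G n)] with x h1 h2
    rw [productPP, h1, h2]
  have hbd : ∃ M : ℝ, ∀ n, ‖fn n‖ * ‖gn n‖ ≤ M := by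
    obtain ⟨M, hM⟩ := (hft.norm.mul hgt.norm).bddAbove_range
    exact ⟨M, fun n => hM (Set.mem_range_self n)⟩
  obtain ⟨M, hM⟩ := hbd
  have hlim : Filter.Tendsto (fun n : ℕ => ∫ t : ℝ, ∫ x : Space d,
      productPP s (fn n) (gn n) t x * k (WithLp.toLp 2 (t, x))) Filter.atTop
      (nhds (∫ t : ℝ, ∫ x : Space d, productPP s f g t x * k (WithLp.toLp 2 (t, x)))) := by
    -- Dominated convergence in t: the slice integrals are at most C(1 + t²)⁻¹ times a bound M for
    -- the products of the norms of the data.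
    refine tendsto_integral_of_dominated_convergence (fun t => C * (1 + t ^ 2)⁻¹ * M) (fun n => ?_)
      ((integrable_inv_one_add_sq.const_mul C).mul_const M)
      (fun n => Filter.Eventually.of_forall fun t => ?_) (Filter.Eventually.of_forall fun t => ?_)
    · simp only [hae]
      have h0 := integrable_wave_mul_wave m k (integrable_truncate F n) (integrable_truncate G n)
      rw [Measure.volume_eq_prod] at h0
      exact h0.integral_prod_left.1
    · refine (norm_integral_mul_mul_le (propagator s t (fn n)) (propagator s t (gn n))
        (hC t)).trans ?_
      rw [norm_propagator, norm_propagator]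
      exact mul_le_mul_of_nonneg_left (hM n) (by positivity)
    · exact tendsto_integral_mul_mul
        (((isometry_propagator s t).continuous.tendsto f).comp hft)
        (((isometry_propagator s t).continuous.tendsto g).comp hgt)
        (hslice t).aestronglyMeasurable (hC t)
  have hkψ : (𝓕⁻ k : 𝓢(SpaceTime d, ℂ)) = ψ := FourierTransform.fourierInv_fourier_eq ψ
  -- On the frequency side no limit is needed: once n exceeds the radius of the support of ψ, the
  -- truncated integrand is the full one.
  obtain ⟨R, hR⟩ := hψ.isCompact.isBounded.exists_norm_le
  obtain ⟨N, hN⟩ := exists_nat_ge R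
  refine tendsto_nhds_unique hlim (tendsto_const_nhds.congr' ?_)
  filter_upwards [Filter.eventually_ge_atTop N] with n hn
  simp only [hae]
  rw [integral_wave_mul_wave m k (integrable_truncate F n) (integrable_truncate G n), hkψ]
  refine integral_congr_ae (Filter.Eventually.of_forall fun z => ?_)
  simp only
  by_cases hz : ψ (momentum m z) = 0
  · rw [hz, mul_zero, mul_zero]
  · have h1 : ‖momentum m z‖ ≤ n :=
      (hR _ (subset_tsupport _ hz)).trans (hN.trans (by exact_mod_cast hn))
    obtain ⟨h2, h3⟩ := mem_closedBall_of_norm_momentum_le h1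
    rw [Set.indicator_of_mem h2, Set.indicator_of_mem h3]

/-! ### Disintegration and Cauchy-Schwarz on fibres -/

theorem sq_lintegral_le {X : Type*} [MeasurableSpace X] (κ : Measure X) [IsProbabilityMeasure κ]
    {f : X → ℝ≥0∞} (hf : Measurable f) : (∫⁻ x, f x ∂κ) ^ 2 ≤ ∫⁻ x, f x ^ 2 ∂κ := by
  have h := ENNReal.lintegral_mul_le_Lp_mul_Lq κ Real.HolderConjugate.two_two hf.aemeasurable
    (aemeasurable_const (b := 1))
  simp only [Pi.mul_apply, mul_one, ENNReal.one_rpow, lintegral_const, measure_univ] at h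
  calc (∫⁻ x, f x ∂κ) ^ 2 ≤ ((∫⁻ x, f x ^ (2 : ℝ) ∂κ) ^ (1 / (2 : ℝ))) ^ 2 := by gcongr
    _ = _ := by
      rw [← ENNReal.rpow_natCast, ← ENNReal.rpow_mul]
      simp

/-- Suppose that `Φ` maps the finite measure `q μ` to `D ν`. Then the image of the complex measure
`h μ` under `Φ` has a density with respect to `ν`, which satisfies the Cauchy-Schwarz inequality on
the fibres of `Φ`. -/
theorem exists_density_map {X Y : Type*} [MeasurableSpace X] [StandardBorelSpace X] [Nonempty X]
    [MeasurableSpace Y] {μ : Measure X} {ν : Measure Y} {Φ : X → Y} (hΦ : Measurable Φ)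
    {q : X → ℝ} (hq : Measurable q) (hq0 : ∀ x, 0 < q x) (hqf : ∫⁻ x, ENNReal.ofReal (q x) ∂μ ≠ ∞)
    {D : Y → ℝ} (hD : Measurable D) (hD0 : ∀ y, 0 ≤ D y)
    (hmap : (μ.withDensity fun x => ENNReal.ofReal (q x)).map Φ =
      ν.withDensity fun y => ENNReal.ofReal (D y))
    {h : X → ℂ} (hh : Measurable h) :
    ∃ H : Y → ℂ, Measurable H ∧
      (∀ ψ : Y → ℂ, Measurable ψ → Integrable (fun x => h x * ψ (Φ x)) μ →
        Integrable (fun y => H y * ψ y) ν ∧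
          ∫ y, H y * ψ y ∂ν = ∫ x, h x * ψ (Φ x) ∂μ) ∧
      ∀ w : Y → ℝ≥0∞, Measurable w →
        ∫⁻ y, w y * ‖H y‖ₑ ^ 2 ∂ν ≤
          ∫⁻ x, w (Φ x) * ENNReal.ofReal (D (Φ x) / q x) * ‖h x‖ₑ ^ 2 ∂μ := by
  set Q : Measure X := μ.withDensity fun x => ENNReal.ofReal (q x) with hQ
  have : IsFiniteMeasure Q := isFiniteMeasure_withDensity hqf
  have hgr : Measurable fun x => (Φ x, x) := hΦ.prodMk measurable_id
  -- Disintegrating the graph measure over Y gives probability measures on the fibres of Φ. This is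
  -- why the reference measure q μ has to be finite.
  set ρ : Measure (Y × X) := Q.map fun x => (Φ x, x) with hρ
  have hfst : ρ.fst = ν.withDensity fun y => ENNReal.ofReal (D y) := by
    rw [hρ, Measure.fst_map_prodMk measurable_id', hmap]
  have hQq (f : X → ℂ) : ∫ x, f x / (q x : ℂ) ∂Q = ∫ x, f x ∂μ := by
    rw [hQ, integral_withDensity_eq_integral_toReal_smul (by fun_prop) (by simp)]
    refine integral_congr_ae (Filter.Eventually.of_forall fun x => ?_)
    have : (q x : ℂ) ≠ 0 := by exact_mod_cast (hq0 x).ne'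
    simp only [ENNReal.toReal_ofReal (hq0 x).le, Complex.real_smul]
    field_simp
  have hQi {f : X → ℂ} (hf : Integrable f μ) : Integrable (fun x => f x / (q x : ℂ)) Q := by
    rw [hQ, integrable_withDensity_iff_integrable_smul' (by fun_prop) (by simp)]
    refine hf.congr (Filter.Eventually.of_forall fun x => ?_)
    have : (q x : ℂ) ≠ 0 := by exact_mod_cast (hq0 x).ne'
    simp only [ENNReal.toReal_ofReal (hq0 x).le, Complex.real_smul]
    field_simp
  -- The conditional mean of h/q on the fibre over y; the density of the image of h μ is then D · J.
  set J : Y → ℂ := fun y => ∫ x, h x / (q x : ℂ) ∂(ρ.condKernel y) with hJ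
  have hJm : Measurable J := by
    have : StronglyMeasurable fun p : Y × X => h p.2 / (q p.2 : ℂ) := by
      apply Measurable.stronglyMeasurable
      fun_prop
    exact (this.integral_kernel_prod_right' (κ := ρ.condKernel)).measurable
  refine ⟨fun y => (D y : ℂ) * J y, by fun_prop, fun ψ hψ hint => ?_, fun w hw => ?_⟩
  · have hfm : Measurable fun p : Y × X => h p.2 * ψ p.1 / (q p.2 : ℂ) := by fun_prop
    have hf : Integrable (fun p : Y × X => h p.2 * ψ p.1 / (q p.2 : ℂ)) ρ := by
      rw [hρ, integrable_map_measure hfm.aestronglyMeasurable hgr.aemeasurable]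
      exact hQi hint
    have hin (y : Y) : ∫ x, h x * ψ y / (q x : ℂ) ∂(ρ.condKernel y) = J y * ψ y := by
      rw [hJ, ← integral_mul_const]
      refine integral_congr_ae (Filter.Eventually.of_forall fun x => ?_)
      simp only
      ring
    constructor
    · have h1 := hf.integral_condKernel
      simp only [hin] at h1
      rw [hfst, integrable_withDensity_iff_integrable_smul' (by fun_prop) (by simp)] at h1
      refine h1.congr (Filter.Eventually.of_forall fun y => ?_)
      simp only [ENNReal.toReal_ofReal (hD0 y), Complex.real_smul]
      ring
    · have h1 := Measure.integral_condKernel hf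
      simp only [hin] at h1
      rw [hfst, integral_withDensity_eq_integral_toReal_smul (by fun_prop) (by simp), hρ,
        integral_map hgr.aemeasurable hfm.aestronglyMeasurable, hQq] at h1
      rw [← h1]
      refine integral_congr_ae (Filter.Eventually.of_forall fun y => ?_)
      simp only [ENNReal.toReal_ofReal (hD0 y), Complex.real_smul]
      ring
  · have hE : Measurable fun x => ‖h x / (q x : ℂ)‖ₑ := by fun_prop
    -- Cauchy-Schwarz for each conditional probability bounds |J|². One factor D reassembles the
    -- disintegration into q μ; the other remains in the weight D/q.
    calc ∫⁻ y, w y * ‖(D y : ℂ) * J y‖ₑ ^ 2 ∂ν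
        ≤ ∫⁻ y, ENNReal.ofReal (D y) * ∫⁻ x, w y * ENNReal.ofReal (D y) * ‖h x / (q x : ℂ)‖ₑ ^ 2
            ∂(ρ.condKernel y) ∂ν := by
          refine lintegral_mono fun y => ?_
          have h1 : ‖J y‖ₑ ^ 2 ≤ ∫⁻ x, ‖h x / (q x : ℂ)‖ₑ ^ 2 ∂(ρ.condKernel y) := by
            refine le_trans ?_ (sq_lintegral_le _ hE)
            gcongr
            exact enorm_integral_le_lintegral_enorm _
          have h2 : ‖(D y : ℂ)‖ₑ = ENNReal.ofReal (D y) := by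
            rw [← ofReal_norm, Complex.norm_real, Real.norm_of_nonneg (hD0 y)]
          rw [lintegral_const_mul _ (by fun_prop), enorm_mul, h2]
          calc _ = ENNReal.ofReal (D y) * (w y * ENNReal.ofReal (D y) * ‖J y‖ₑ ^ 2) := by ring
            _ ≤ _ := by gcongr
      _ = ∫⁻ y, ∫⁻ x, w y * ENNReal.ofReal (D y) * ‖h x / (q x : ℂ)‖ₑ ^ 2
            ∂(ρ.condKernel y) ∂ρ.fst := by
          rw [hfst, lintegral_withDensity_eq_lintegral_mul _ (by fun_prop)]
          · rfl
          · exact Measurable.lintegral_kernel_prod_right'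
              (f := fun p : Y × X => w p.1 * ENNReal.ofReal (D p.1) * ‖h p.2 / (q p.2 : ℂ)‖ₑ ^ 2)
              (by fun_prop)
      _ = ∫⁻ p, w p.1 * ENNReal.ofReal (D p.1) * ‖h p.2 / (q p.2 : ℂ)‖ₑ ^ 2 ∂ρ :=
          Measure.lintegral_condKernel
            (f := fun p : Y × X => w p.1 * ENNReal.ofReal (D p.1) * ‖h p.2 / (q p.2 : ℂ)‖ₑ ^ 2)
            (by fun_prop)
      _ = ∫⁻ x, w (Φ x) * ENNReal.ofReal (D (Φ x)) * ‖h x / (q x : ℂ)‖ₑ ^ 2 ∂Q := by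
          rw [hρ, lintegral_map (by fun_prop) hgr]
      _ = _ := by
          rw [hQ, lintegral_withDensity_eq_lintegral_mul _ (by fun_prop) (by fun_prop)]
          refine lintegral_congr fun x => ?_
          have h2 : ‖h x / (q x : ℂ)‖ₑ = ‖h x‖ₑ * ENNReal.ofReal (q x)⁻¹ := by
            rw [div_eq_mul_inv, enorm_mul, ← Complex.ofReal_inv,
              ← ofReal_norm (((q x)⁻¹ : ℝ) : ℂ), Complex.norm_real,
              Real.norm_of_nonneg (inv_nonneg.2 (hq0 x).le)]
          have h3 : ENNReal.ofReal (q x) * ENNReal.ofReal (q x)⁻¹ = 1 := by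
            rw [← ENNReal.ofReal_mul (hq0 x).le, mul_inv_cancel₀ (hq0 x).ne', ENNReal.ofReal_one]
          simp only [Pi.mul_apply]
          rw [h2, div_eq_mul_inv, ENNReal.ofReal_mul (hD0 _)]
          calc _ = (ENNReal.ofReal (q x) * ENNReal.ofReal (q x)⁻¹) * (w (Φ x) *
                (ENNReal.ofReal (D (Φ x)) * ENNReal.ofReal (q x)⁻¹) * ‖h x‖ₑ ^ 2) := by ring
            _ = _ := by rw [h3, one_mul]

/-! ### The extremal profile -/

theorem integrable_exp_neg_norm {d : ℕ} (hd : 2 ≤ d) :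
    Integrable fun ξ : Space d => Real.exp (-‖ξ‖) := by
  have : Nontrivial (Space d) := by
    have : Nontrivial (Fin d) := Fin.nontrivial_iff_two_le.2 hd
    infer_instance
  rw [integrable_fun_norm_addHaar volume (f := fun r => Real.exp (-r))]
  have h := Real.GammaIntegral_convergent (s := d) (by positivity)
  refine h.congr_fun (fun r hr => ?_) measurableSet_Ioi
  simp only [finrank_euclideanSpace, Fintype.card_fin, smul_eq_mul]
  rw [mul_comm, ← Real.rpow_natCast, Nat.cast_sub (by omega), Nat.cast_one]

/-- The profile `e^{-ω} / ω` of an extremiser. -/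
def extremal {d : ℕ} (m : ℝ) (ξ : Space d) : ℝ := Real.exp (-energy m ξ) / energy m ξ

theorem extremal_pos {d : ℕ} {m : ℝ} (hm : 0 < m) (ξ : Space d) : 0 < extremal m ξ :=
  div_pos (Real.exp_pos _) (energy_pos hm ξ)

@[fun_prop]
theorem measurable_extremal {d : ℕ} (m : ℝ) : Measurable (extremal m : Space d → ℝ) := by
  unfold extremal; fun_prop

theorem lintegral_extremal_mul_extremal_ne_top {d : ℕ} (hd : 2 ≤ d) {m : ℝ} (hm : 0 < m) :
    ∫⁻ x : Space d × Space d, ENNReal.ofReal (extremal m x.1 * extremal m x.2) ≠ ∞ := by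
  have h1 : Integrable (extremal m : Space d → ℝ) := by
    refine ((integrable_exp_neg_norm hd).const_mul m⁻¹).mono (by fun_prop)
      (Filter.Eventually.of_forall fun ξ => ?_)
    rw [Real.norm_of_nonneg (extremal_pos hm ξ).le, Real.norm_of_nonneg (by positivity), extremal,
      div_eq_inv_mul]
    have h2 : m ≤ energy m ξ := Real.le_sqrt_of_sq_le (by nlinarith [sq_nonneg ‖ξ‖])
    have h3 := norm_le_energy m ξ
    gcongr
  have h2 : Integrable fun x : Space d × Space d => extremal m x.1 * extremal m x.2 := by
    rw [Measure.volume_eq_prod]; exact h1.mul_prod h1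
  exact h2.lintegral_lt_top.ne

/-- The profile differs from 1/(ωω) by a function of the total energy, constant on each fibre of
`momentum`. It makes the reference measure finite and cancels in the quotient D/q. -/
theorem extremal_mul_extremal {d : ℕ} (m : ℝ) (x : Space d × Space d) :
    extremal m x.1 * extremal m x.2 =
      Real.exp (-(momentum m x).fst) * (1 / (energy m x.1 * energy m x.2)) := by
  unfold extremal momentum
  simp only [WithLp.toLp_fst]
  rw [neg_add, Real.exp_add, div_mul_div_comm, mul_one_div]

theorem lintegral_momentum_extremal {d : ℕ} (hd : 2 ≤ d) {m : ℝ} (hm : 0 < m)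
    {h : SpaceTime d → ℝ≥0∞} (hh : Measurable h) :
    ∫⁻ x : Space d × Space d, h (momentum m x) *
        ENNReal.ofReal (extremal m x.1 * extremal m x.2) =
      ∫⁻ p : SpaceTime d, h p * ENNReal.ofReal (Real.exp (-p.fst) * collisionDensity m p) := by
  have h1 := lintegral_momentum hd hm
    (h := fun p : SpaceTime d => h p * ENNReal.ofReal (Real.exp (-p.fst))) (by fun_prop)
  simp only [mul_assoc, ← ENNReal.ofReal_mul (Real.exp_pos _).le] at h1
  rw [← h1]
  simp only [extremal_mul_extremal]

theorem map_momentum_extremal {d : ℕ} (hd : 2 ≤ d) {m : ℝ} (hm : 0 < m) :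
    ((volume : Measure (Space d × Space d)).withDensity fun x =>
        ENNReal.ofReal (extremal m x.1 * extremal m x.2)).map (momentum m) =
      (volume : Measure (SpaceTime d)).withDensity fun p =>
        ENNReal.ofReal (Real.exp (-p.fst) * collisionDensity m p) := by
  have hΦ : Measurable (momentum m : Space d × Space d → SpaceTime d) :=
    (continuous_momentum m).measurable
  refine Measure.ext_of_lintegral _ fun h hh => ?_
  rw [lintegral_map hh hΦ, lintegral_withDensity_eq_lintegral_mul _ (by fun_prop) (by fun_prop),
    lintegral_withDensity_eq_lintegral_mul _ (by fun_prop) hh]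
  simp only [Pi.mul_apply, mul_comm _ (h _)]
  exact lintegral_momentum_extremal hd hm hh

/-! ### The constant -/

theorem toSphere_real_univ {d : ℕ} (hd : 1 ≤ d) :
    (volume : Measure (Space d)).toSphere.real Set.univ =
      2 * Real.pi ^ ((d : ℝ) / 2) / Real.Gamma ((d : ℝ) / 2) := by
  have : Nonempty (Fin d) := ⟨⟨0, by omega⟩⟩
  have hd' : (0 : ℝ) < d := by exact_mod_cast hd
  rw [Measure.toSphere_real_apply_univ, Measure.real, EuclideanSpace.volume_ball,
    ENNReal.ofReal_one, one_pow, one_mul, ENNReal.toReal_ofReal (by positivity),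
    finrank_euclideanSpace, Fintype.card_fin, Real.Gamma_add_one (by positivity),
    Real.sqrt_eq_rpow, ← Real.rpow_natCast, ← Real.rpow_mul Real.pi_pos.le]
  have := Real.Gamma_pos_of_pos (half_pos hd')
  rw [show (1 / 2 * (d : ℝ)) = (d : ℝ) / 2 by ring]
  field_simp

theorem KGpp_pos {d : ℕ} (hd : 2 ≤ d) (β : ℝ) : 0 < KGpp β d := by
  have hd' : (2 : ℝ) ≤ d := by exact_mod_cast hd
  have h1 := Real.Gamma_pos_of_pos (show 0 < ((d : ℝ) - 1) / 2 by linarith)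
  have h2 := Real.Gamma_pos_of_pos (show 0 < (d : ℝ) - 1 by linarith)
  unfold KGpp
  positivity

/-- A and B stand for ω(ξ)ω(η) - ξ·η ∓ m². Logarithms make the comparison linear in log 2, log π,
log A, log B and the log-Gamma terms. -/
theorem constant_identity {d : ℕ} (hd : 2 ≤ d) (β : ℝ) {A B : ℝ} (hA : 0 < A) (hB : 0 < B) :
    (2 ^ 3 * Real.pi ^ 2 * A) ^ (2 * β) *
      ((volume : Measure (Space d)).toSphere.real Set.univ * 2 ^ (2 - (d : ℝ)) *
        (2 * A) ^ (((d : ℝ) - 2) / 2) / Real.sqrt (2 * B)) =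
      KGpp β d * ((2 * Real.pi) ^ (2 * d) * (2 * Real.pi) ^ 2 *
        ((2 ^ 2 * Real.pi ^ 2 * A) ^ (((d : ℝ) - 2) / 2 + 2 * β) /
          (2 ^ 2 * Real.pi ^ 2 * B) ^ (1 / 2 : ℝ))) := by
  have hd' : (2 : ℝ) ≤ d := by exact_mod_cast hd
  have g1 := Real.Gamma_pos_of_pos (show 0 < (d : ℝ) / 2 by linarith)
  have g2 := Real.Gamma_pos_of_pos (show 0 < ((d : ℝ) - 1) / 2 by linarith)
  have g3 := Real.Gamma_pos_of_pos (show 0 < (d : ℝ) - 1 by linarith)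
  have hK := KGpp_pos hd β
  have hπ := Real.pi_pos
  -- Legendre duplication at (d-1)/2 converts the Γ(d/2) of the sphere's area into the quotient
  -- Γ((d-1)/2)/Γ(d-1) of the constant.
  have dup := congrArg Real.log (Real.Gamma_mul_Gamma_add_half (((d : ℝ) - 1) / 2))
  rw [show ((d : ℝ) - 1) / 2 + 1 / 2 = d / 2 by ring,
    show 2 * (((d : ℝ) - 1) / 2) = d - 1 by ring, Real.log_mul g2.ne' g1.ne',
    Real.log_mul (by positivity) (by positivity), Real.log_mul (by positivity) (by positivity),
    Real.log_rpow (by norm_num), Real.log_sqrt hπ.le] at dup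
  rw [toSphere_real_univ (by omega), Real.sqrt_eq_rpow]
  refine Real.log_injOn_pos (Set.mem_Ioi.2 (by positivity)) (Set.mem_Ioi.2 (by positivity)) ?_
  have l1 : Real.log (KGpp β d) = ((-5 * (d : ℝ) + 1) / 2 + 2 * β) * Real.log 2 +
      ((-5 * (d : ℝ) + 1) / 2) * Real.log Real.pi +
      (Real.log (Real.Gamma (((d : ℝ) - 1) / 2)) - Real.log (Real.Gamma ((d : ℝ) - 1))) := by
    unfold KGpp
    rw [Real.log_mul (by positivity) (by positivity), Real.log_mul (by positivity) (by positivity),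
      Real.log_rpow (by norm_num), Real.log_rpow hπ, Real.log_div g2.ne' g3.ne']
  have l2 (n : ℕ) {x : ℝ} (hx : 0 < x) : Real.log (2 ^ n * Real.pi ^ 2 * x) =
      n * Real.log 2 + 2 * Real.log Real.pi + Real.log x := by
    rw [Real.log_mul (by positivity) hx.ne', Real.log_mul (by positivity) (by positivity),
      Real.log_pow, Real.log_pow]
    push_cast; ring
  have l3 {x : ℝ} (hx : 0 < x) : Real.log (2 * x) = Real.log 2 + Real.log x :=
    Real.log_mul two_ne_zero hx.ne'
  rw [Real.log_mul (by positivity) (by positivity), Real.log_rpow (by positivity), l2 3 hA,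
    Real.log_div (by positivity) (by positivity), Real.log_rpow (by positivity), l3 hB,
    Real.log_mul (by positivity) (by positivity), Real.log_mul (by positivity) (by positivity),
    Real.log_rpow (by positivity), Real.log_rpow (by positivity), l3 hA,
    Real.log_div (by positivity) (by positivity), l3 (by positivity), Real.log_rpow (by positivity),
    Real.log_mul hK.ne' (by positivity), l1,
    Real.log_mul (by positivity) (by positivity), Real.log_mul (by positivity) (by positivity),
    Real.log_pow, Real.log_pow, l3 hπ, Real.log_div (by positivity) (by positivity),
    Real.log_rpow (by positivity), Real.log_rpow (by positivity), l2 2 hA, l2 2 hB]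
  push_cast
  linear_combination (-1 : ℝ) * dup

/-! ### Symbol, density and kernel in the variables (ξ, η) -/

section
variable {d : ℕ} {m : ℝ}

theorem momentum_gap (m : ℝ) (z : Space d × Space d) :
    (momentum m z).fst ^ 2 - ‖(momentum m z).snd‖ ^ 2 - 4 * m ^ 2 =
      2 * (energy m z.1 * energy m z.2 - inner ℝ z.1 z.2 - m ^ 2) := by
  simp only [momentum, WithLp.toLp_fst, WithLp.toLp_snd]
  rw [norm_add_sq_real, add_sq, energy_sq, energy_sq]
  ring

/-- The square of ω(ξ)ω(η) exceeds that of ξ·η + m² by m²|ξ - η|² + (|ξ|²|η|² - (ξ·η)²), whose first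
term is positive. -/
theorem gap_pos (hm : 0 < m) {ξ η : Space d} (h : ξ ≠ η) :
    0 < energy m ξ * energy m η - inner ℝ ξ η - m ^ 2 := by
  have h1 : 0 < ‖ξ - η‖ := norm_pos_iff.2 (sub_ne_zero.2 h)
  have h2 : ‖ξ - η‖ ^ 2 = ‖ξ‖ ^ 2 - 2 * inner ℝ ξ η + ‖η‖ ^ 2 := norm_sub_sq_real ξ η
  have h3 := abs_real_inner_le_norm ξ η
  have h4 : (inner ℝ ξ η) ^ 2 ≤ ‖ξ‖ ^ 2 * ‖η‖ ^ 2 := by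
    rw [← mul_pow]; exact sq_le_sq' (abs_le.1 h3).1 (abs_le.1 h3).2
  have h5 : (inner ℝ ξ η + m ^ 2) ^ 2 < (energy m ξ * energy m η) ^ 2 := by
    rw [mul_pow, energy_sq, energy_sq]
    nlinarith [mul_pos (pow_pos hm 2) (pow_pos h1 2)]
  have := lt_of_pow_lt_pow_left₀ 2 (mul_pos (energy_pos hm ξ) (energy_pos hm η)).le h5
  linarith

theorem gap_self (m : ℝ) (ξ : Space d) :
    energy m ξ * energy m ξ - inner ℝ ξ ξ - m ^ 2 = 0 := by
  rw [← pow_two, energy_sq, real_inner_self_eq_norm_sq]; ring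

theorem nullSymbol_eq {s : ℝ} (p : SpaceTime d) : nullSymbol s p =
    |2 ^ 2 * Real.pi ^ 2 * (p.fst ^ 2 - ‖p.snd‖ ^ 2 - 4 * (s / (2 * Real.pi)) ^ 2)| := by
  unfold nullSymbol
  congr 1
  field_simp
  ring

theorem nullSymbol_nonneg (s : ℝ) (p : SpaceTime d) : 0 ≤ nullSymbol s p := abs_nonneg _

@[fun_prop]
theorem measurable_nullSymbol (s : ℝ) : Measurable (nullSymbol s : SpaceTime d → ℝ) := by
  unfold nullSymbol
  fun_prop

theorem collisionDensity_momentum (hm : 0 < m) {z : Space d × Space d} (hz : z.1 ≠ z.2) :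
    collisionDensity m (momentum m z) =
      (volume : Measure (Space d)).toSphere.real Set.univ * 2 ^ (2 - (d : ℝ)) *
        (2 * (energy m z.1 * energy m z.2 - inner ℝ z.1 z.2 - m ^ 2)) ^ (((d : ℝ) - 2) / 2) /
        Real.sqrt (2 * (energy m z.1 * energy m z.2 - inner ℝ z.1 z.2 + m ^ 2)) := by
  have hA := gap_pos hm hz
  have hg := momentum_gap m z
  have h0 : 0 < (momentum m z).fst := add_pos (energy_pos hm _) (energy_pos hm _)
  rw [collisionDensity, if_pos, hg]
  · congr 2; linarith
  · rw [Real.sqrt_lt' h0]; linarith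

/-- Equal momenta sit exactly on the threshold, which the strict inequality in the density excludes.
-/
theorem collisionDensity_momentum_diag (hm : 0 < m) {z : Space d × Space d} (hz : z.1 = z.2) :
    collisionDensity m (momentum m z) = 0 := by
  have hg := momentum_gap m z
  rw [← hz, gap_self] at hg
  have h0 : 0 < (momentum m z).fst := add_pos (energy_pos hm _) (energy_pos hm _)
  rw [collisionDensity, if_neg]
  rw [Real.sqrt_lt' h0]; linarith

/-- The weight of `dataIntegral` after rescaling the frequencies by `2π`. -/
def dataWeight (s β : ℝ) (z : Space d × Space d) : ℝ :=
  (2 * Real.pi) ^ (2 * d) * (phi s ‖(2 * Real.pi) • z.1‖ * phi s ‖(2 * Real.pi) • z.2‖ *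
    kernel s (1 / 2) (((d : ℝ) - 2) / 2 + 2 * β) ((2 * Real.pi) • z.1) ((2 * Real.pi) • z.2))

theorem phi_smul (s : ℝ) (ξ : Space d) :
    phi s ‖(2 * Real.pi) • ξ‖ = 2 * Real.pi * energy (s / (2 * Real.pi)) ξ := by
  rw [norm_smul, Real.norm_of_nonneg (by positivity), phi_two_pi]

theorem dataWeight_eq (s β : ℝ) (z : Space d × Space d) :
    dataWeight s β z = energy (s / (2 * Real.pi)) z.1 * energy (s / (2 * Real.pi)) z.2 *
      ((2 * Real.pi) ^ (2 * d) * (2 * Real.pi) ^ 2 *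
      ((2 ^ 2 * Real.pi ^ 2 * (energy (s / (2 * Real.pi)) z.1 * energy (s / (2 * Real.pi)) z.2 -
        inner ℝ z.1 z.2 - (s / (2 * Real.pi)) ^ 2)) ^ (((d : ℝ) - 2) / 2 + 2 * β) /
      (2 ^ 2 * Real.pi ^ 2 * (energy (s / (2 * Real.pi)) z.1 * energy (s / (2 * Real.pi)) z.2 -
        inner ℝ z.1 z.2 + (s / (2 * Real.pi)) ^ 2)) ^ (1 / 2 : ℝ))) := by
  unfold dataWeight kernel
  rw [phi_smul, phi_smul, real_inner_smul_left, real_inner_smul_right]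
  have hs : s = 2 * Real.pi * (s / (2 * Real.pi)) := by field_simp
  set m := s / (2 * Real.pi)
  rw [hs]
  rw [show 2 * Real.pi * energy m z.1 * (2 * Real.pi * energy m z.2) -
      2 * Real.pi * (2 * Real.pi * inner ℝ z.1 z.2) - (2 * Real.pi * m) ^ 2 =
      2 ^ 2 * Real.pi ^ 2 * (energy m z.1 * energy m z.2 - inner ℝ z.1 z.2 - m ^ 2) by ring,
    show 2 * Real.pi * energy m z.1 * (2 * Real.pi * energy m z.2) -
      2 * Real.pi * (2 * Real.pi * inner ℝ z.1 z.2) + (2 * Real.pi * m) ^ 2 =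
      2 ^ 2 * Real.pi ^ 2 * (energy m z.1 * energy m z.2 - inner ℝ z.1 z.2 + m ^ 2) by ring]
  ring

theorem gap_nonneg (hm : 0 < m) (ξ η : Space d) :
    0 ≤ energy m ξ * energy m η - inner ℝ ξ η - m ^ 2 := by
  by_cases h : ξ = η
  · rw [h, gap_self]
  · exact (gap_pos hm h).le

theorem dataWeight_nonneg {s : ℝ} (hs : 0 < s) (β : ℝ) (z : Space d × Space d) :
    0 ≤ dataWeight s β z := by
  have hm : 0 < s / (2 * Real.pi) := by positivity
  rw [dataWeight_eq]
  have h := gap_nonneg hm z.1 z.2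
  have h' : 0 ≤ energy (s / (2 * Real.pi)) z.1 * energy (s / (2 * Real.pi)) z.2 -
        inner ℝ z.1 z.2 + (s / (2 * Real.pi)) ^ 2 := by
    have := pow_pos hm 2
    linarith
  have h1 := energy_pos hm z.1
  have h2 := energy_pos hm z.2
  positivity

/-- The pointwise identity from which the sharp constant comes: Cauchy-Schwarz on the fibres
produces the left side as weight of |FG|². -/
theorem nullSymbol_mul_collisionDensity (hd : 2 ≤ d) {s : ℝ} (hs : 0 < s) (β : ℝ)
    {z : Space d × Space d} (hz : z.1 ≠ z.2) :
    nullSymbol s (momentum (s / (2 * Real.pi)) z) ^ (2 * β) *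
        collisionDensity (s / (2 * Real.pi)) (momentum (s / (2 * Real.pi)) z) *
        (energy (s / (2 * Real.pi)) z.1 * energy (s / (2 * Real.pi)) z.2) =
      KGpp β d * dataWeight s β z := by
  have hm : 0 < s / (2 * Real.pi) := by positivity
  rw [dataWeight_eq, nullSymbol_eq, collisionDensity_momentum hm hz, momentum_gap]
  set m := s / (2 * Real.pi)
  have hA := gap_pos hm hz
  have hB : 0 < energy m z.1 * energy m z.2 - inner ℝ z.1 z.2 + m ^ 2 := by
    have := pow_pos hm 2
    linarith
  have key := constant_identity hd β hA hB
  rw [abs_of_pos (by positivity), show ∀ A : ℝ, 2 ^ 2 * Real.pi ^ 2 * (2 * A) =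
    2 ^ 3 * Real.pi ^ 2 * A by intro A; ring, key]
  ring

theorem nullSymbol_mul_collisionDensity_le (hd : 2 ≤ d) {s : ℝ} (hs : 0 < s) (β : ℝ)
    (z : Space d × Space d) :
    nullSymbol s (momentum (s / (2 * Real.pi)) z) ^ (2 * β) *
        collisionDensity (s / (2 * Real.pi)) (momentum (s / (2 * Real.pi)) z) *
        (energy (s / (2 * Real.pi)) z.1 * energy (s / (2 * Real.pi)) z.2) ≤
      KGpp β d * dataWeight s β z := by
  by_cases hz : z.1 = z.2
  · rw [collisionDensity_momentum_diag (by positivity) hz, mul_zero, zero_mul]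
    exact mul_nonneg (KGpp_pos hd β).le (dataWeight_nonneg hs β z)
  · exact (nullSymbol_mul_collisionDensity hd hs β hz).le

theorem dataIntegral_eq (s β : ℝ) (f g : L2 d) :
    dataIntegral s β f g = ∫⁻ z : Space d × Space d, ENNReal.ofReal (dataWeight s β z) *
      (‖(𝓕 f : L2 d) z.1‖ₑ ^ 2 * ‖(𝓕 g : L2 d) z.2‖ₑ ^ 2) := by
  set c : ℝ := 2 * Real.pi with hc
  have hc0 : 0 < c := by positivity
  have mF : Measurable ((𝓕 f : L2 d) : Space d → ℂ) := (Lp.stronglyMeasurable _).measurable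
  have mG : Measurable ((𝓕 g : L2 d) : Space d → ℂ) := (Lp.stronglyMeasurable _).measurable
  have mf : Measurable (hat f) := by unfold hat; fun_prop
  have mg : Measurable (hat g) := by unfold hat; fun_prop
  have mφ : Measurable (phi s) := by unfold phi; fun_prop
  have mk : Measurable fun η : Space d × Space d =>
      kernel s (1 / 2) (((d : ℝ) - 2) / 2 + 2 * β) η.1 η.2 := by unfold kernel; fun_prop
  have hfr : Module.finrank ℝ (Space d × Space d) = 2 * d := by
    simp [two_mul]
  have : (volume : Measure (Space d × Space d)).IsAddHaarMeasure := by
    rw [Measure.volume_eq_prod]; infer_instance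
  have hmap := Measure.map_addHaar_smul (volume : Measure (Space d × Space d)) hc0.ne'
  rw [hfr, abs_of_pos (by positivity)] at hmap
  have hscale (Ψ : Space d × Space d → ℝ≥0∞) (hΨ : Measurable Ψ) :
      ∫⁻ η, Ψ η = ∫⁻ z, ENNReal.ofReal (c ^ (2 * d)) * Ψ (c • z) := by
    rw [lintegral_const_mul _ (by fun_prop),
      ← lintegral_map (g := fun z : Space d × Space d => c • z) hΨ (by fun_prop), hmap,
      lintegral_smul_measure, smul_eq_mul, ← mul_assoc, ← ENNReal.ofReal_mul (by positivity),
      mul_inv_cancel₀ (by positivity), ENNReal.ofReal_one, one_mul]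
  unfold dataIntegral
  rw [hscale _ (by fun_prop)]
  refine lintegral_congr fun z => ?_
  have e1 (F : Space d → ℂ) (ξ : Space d) : ‖F ξ‖ₑ ^ 2 = ENNReal.ofReal (‖F ξ‖ ^ 2) := by
    rw [ENNReal.ofReal_pow (norm_nonneg _), ofReal_norm]
  have e2 (F : L2 d) (ξ : Space d) : hat F (c • ξ) = (𝓕 F : L2 d) ξ := by
    rw [hat, smul_smul, inv_mul_cancel₀ hc0.ne', one_smul]
  rw [e1, e1, ← ENNReal.ofReal_mul (p := c ^ (2 * d)) (by positivity),
    ← ENNReal.ofReal_mul (p := ‖(𝓕 f : L2 d) z.1‖ ^ 2) (by positivity),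
    ← ENNReal.ofReal_mul' (by positivity), dataWeight]
  simp only [Prod.smul_fst, Prod.smul_snd, e2]
  congr 1
  ring
end

/-! ### The inequality -/

section

variable {d : ℕ}

/-- F and G are only square integrable, but a bounded support of ψ confines both momenta to a ball,
where they are integrable. -/
theorem integrable_mul_comp_momentum (m : ℝ) (F G : L2 d) {ψ : SpaceTime d → ℂ}
    (hψ : Measurable ψ) {C R : ℝ} (hC : ∀ p, ‖ψ p‖ ≤ C) (hR : ∀ p, ψ p ≠ 0 → ‖p‖ ≤ R) :
    Integrable fun z : Space d × Space d => F z.1 * G z.2 * ψ (momentum m z) := by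
  obtain ⟨n, hn⟩ := exists_nat_ge R
  have h1 : Integrable fun z : Space d × Space d =>
      (Metric.closedBall (0 : Space d) n).indicator F z.1 *
        (Metric.closedBall (0 : Space d) n).indicator G z.2 := by
    rw [Measure.volume_eq_prod]
    exact (integrable_truncate F n).mul_prod (integrable_truncate G n)
  refine (h1.mul_bdd (c := C) (g := fun z => ψ (momentum m z))
    (hψ.comp (continuous_momentum m).measurable).aestronglyMeasurable
    (Filter.Eventually.of_forall fun z => hC _)).congr (Filter.Eventually.of_forall fun z => ?_)
  simp only
  by_cases hz : ψ (momentum m z) = 0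
  · rw [hz, mul_zero, mul_zero]
  · obtain ⟨h2, h3⟩ := mem_closedBall_of_norm_momentum_le ((hR _ hz).trans hn)
    rw [Set.indicator_of_mem h2, Set.indicator_of_mem h3]

/-- The space-time Fourier transform of a product of two waves is a function, whose weighted `L²`
norms are controlled by the Cauchy-Schwarz inequality on the fibres of `momentum`. -/
theorem exists_hasSpaceTimeFourier_productPP (hd : 2 ≤ d) {s : ℝ} (hs : 0 < s) (f g : L2 d) :
    ∃ H : SpaceTime d → ℂ, Measurable H ∧ HasSpaceTimeFourier (productPP s f g) H ∧
      ∀ w : SpaceTime d → ℝ≥0∞, Measurable w → ∫⁻ p, w p * ‖H p‖ₑ ^ 2 ≤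
        ∫⁻ z : Space d × Space d, w (momentum (s / (2 * Real.pi)) z) * ENNReal.ofReal
          (collisionDensity (s / (2 * Real.pi)) (momentum (s / (2 * Real.pi)) z) *
            (energy (s / (2 * Real.pi)) z.1 * energy (s / (2 * Real.pi)) z.2)) *
          (‖(𝓕 f : L2 d) z.1‖ₑ ^ 2 * ‖(𝓕 g : L2 d) z.2‖ₑ ^ 2) := by
  have hm : 0 < s / (2 * Real.pi) := by positivity
  have hpair := integral_productPP s f g
  set m := s / (2 * Real.pi)
  have mF : Measurable ((𝓕 f : L2 d) : Space d → ℂ) := (Lp.stronglyMeasurable _).measurable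
  have mG : Measurable ((𝓕 g : L2 d) : Space d → ℂ) := (Lp.stronglyMeasurable _).measurable
  obtain ⟨H, hHm, h1, h2⟩ := exists_density_map (continuous_momentum m).measurable
    (q := fun z : Space d × Space d => extremal m z.1 * extremal m z.2) (by fun_prop)
    (fun z => mul_pos (extremal_pos hm _) (extremal_pos hm _))
    (lintegral_extremal_mul_extremal_ne_top hd hm)
    (D := fun p : SpaceTime d => Real.exp (-p.fst) * collisionDensity m p) (by fun_prop)
    (fun p => mul_nonneg (Real.exp_pos _).le (collisionDensity_nonneg m p))
    (map_momentum_extremal hd hm)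
    (h := fun z : Space d × Space d => (𝓕 f : L2 d) z.1 * (𝓕 g : L2 d) z.2) (by fun_prop)
  refine ⟨H, hHm, ⟨?_, fun ψ hψ => ?_⟩, fun w hw => (h2 w hw).trans_eq ?_⟩
  · rw [locallyIntegrable_iff]
    intro K hK
    obtain ⟨R, hR⟩ := hK.isBounded.exists_norm_le
    have hKm := hK.isClosed.measurableSet
    -- Testing with the indicator of a compact set gives local integrability of H.
    have h3 := (h1 (K.indicator fun _ => 1) (measurable_const.indicator hKm)
      (integrable_mul_comp_momentum m _ _ (measurable_const.indicator hKm) (C := 1) (R := R)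
        (fun p => ?_) fun p hp => ?_)).1
    · rw [← integrable_indicator_iff hKm]
      refine h3.congr (Filter.Eventually.of_forall fun p => ?_)
      by_cases hp : p ∈ K <;> simp [hp]
    · by_cases hp : p ∈ K <;> simp [hp]
    · by_cases hp' : p ∈ K
      · exact hR p hp'
      · simp [hp'] at hp
  · obtain ⟨R, hR⟩ := hψ.isCompact.isBounded.exists_norm_le
    obtain ⟨C, -, hC⟩ := ψ.decay 0 0
    simp only [norm_iteratedFDeriv_zero, pow_zero, one_mul] at hC
    rw [hpair ψ hψ]
    exact (h1 ψ ψ.continuous.measurable (integrable_mul_comp_momentum m _ _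
      ψ.continuous.measurable hC fun p hp => hR p (subset_tsupport _ hp))).2.symm
  · refine lintegral_congr fun z => ?_
    have e1 := energy_pos hm z.1
    have e2 := energy_pos hm z.2
    simp only [extremal_mul_extremal, enorm_mul, mul_pow]
    congr 3
    field_simp

theorem enorm_rpow_mul_sq {x : ℝ} (hx : 0 ≤ x) (β : ℝ) (a : ℂ) :
    ‖((x ^ β : ℝ) : ℂ) * a‖ₑ ^ 2 = ENNReal.ofReal (x ^ (2 * β)) * ‖a‖ₑ ^ 2 := by
  rw [enorm_mul, mul_pow, ← ofReal_norm, Complex.norm_real,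
    Real.norm_of_nonneg (Real.rpow_nonneg hx _), ← ENNReal.ofReal_pow (Real.rpow_nonneg hx _),
    mul_comm 2 β, Real.rpow_mul hx, Real.rpow_two]

theorem enorm_sq_L2ST (G : L2ST d) : ‖G‖ₑ ^ 2 = ∫⁻ p, ‖G p‖ₑ ^ 2 := by
  rw [Lp.enorm_def, eLpNorm_eq_lintegral_rpow_enorm_toReal (by norm_num) (by norm_num),
    ← ENNReal.rpow_natCast, ← ENNReal.rpow_mul]
  simp

theorem enorm_fourier_L2ST (G : L2ST d) : ‖(𝓕 G : L2ST d)‖ₑ = ‖G‖ₑ := by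
  rw [← ofReal_norm, ← ofReal_norm, Lp.norm_fourier_eq]

/-- When the right side is finite, the inverse transform of the symbol power times H is an
admissible G; otherwise there is nothing to prove. -/
theorem nullFormNormSq_le_lintegral {s β : ℝ} {W : ℝ → Space d → ℂ} {H : SpaceTime d → ℂ}
    (hHm : Measurable H) (hH : HasSpaceTimeFourier W H) :
    nullFormNormSq s β W ≤ ∫⁻ p, ENNReal.ofReal (nullSymbol s p ^ (2 * β)) * ‖H p‖ₑ ^ 2 := by
  set K : SpaceTime d → ℂ := fun p => ((nullSymbol s p ^ β : ℝ) : ℂ) * H p with hK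
  have hKe : ∫⁻ p, ENNReal.ofReal (nullSymbol s p ^ (2 * β)) * ‖H p‖ₑ ^ 2 = ∫⁻ p, ‖K p‖ₑ ^ 2 :=
    lintegral_congr fun p => (enorm_rpow_mul_sq (nullSymbol_nonneg s p) β _).symm
  have hKm : Measurable K := by fun_prop
  rw [hKe]
  by_cases hfin : ∫⁻ p, ‖K p‖ₑ ^ 2 = ∞
  · rw [hfin]; exact le_top
  have hK2 : MemLp K 2 := by
    refine ⟨hKm.aestronglyMeasurable, ?_⟩
    rw [eLpNorm_eq_lintegral_rpow_enorm_toReal (by norm_num) (by norm_num)]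
    refine ENNReal.rpow_lt_top_of_nonneg (by positivity) ?_
    simpa using hfin
  have hF : (𝓕 (𝓕⁻ (hK2.toLp K) : L2ST d) : L2ST d) = hK2.toLp K :=
    FourierTransform.fourier_fourierInv_eq _
  have hG : IsNullFormPower s β W (𝓕⁻ (hK2.toLp K) : L2ST d) := by
    refine ⟨H, hH, ?_⟩
    rw [hF]; exact hK2.coeFn_toLp
  refine (iInf₂_le _ hG).trans ?_
  rw [← enorm_fourier_L2ST, hF, enorm_sq_L2ST]
  refine le_of_eq (lintegral_congr_ae ?_)
  filter_upwards [hK2.coeFn_toLp] with p hp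
  rw [hp]

theorem nullFormNormSq_productPP_le (hd : 2 ≤ d) {s : ℝ} (hs : 0 < s) (β : ℝ) (f g : L2 d) :
    nullFormNormSq s β (productPP s f g) ≤
      ENNReal.ofReal (KGpp β d) * dataIntegral s β f g := by
  obtain ⟨H, hHm, hH, hw⟩ := exists_hasSpaceTimeFourier_productPP hd hs f g
  refine (nullFormNormSq_le_lintegral hHm hH).trans ((hw _ (by fun_prop)).trans ?_)
  rw [dataIntegral_eq, ← lintegral_const_mul' _ _ ENNReal.ofReal_ne_top]
  refine lintegral_mono fun z => ?_
  rw [← mul_assoc (ENNReal.ofReal (KGpp β d)), ← ENNReal.ofReal_mul (Real.rpow_nonneg (nullSymbol_nonneg s _) _),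
    ← ENNReal.ofReal_mul (KGpp_pos hd β).le, ← mul_assoc (nullSymbol s _ ^ (2 * β))]
  exact mul_le_mul' (ENNReal.ofReal_le_ofReal (nullSymbol_mul_collisionDensity_le hd hs β z)) le_rfl

/-! ### Sharpness -/

theorem contDiff_extremal {m : ℝ} (hm : 0 < m) {n : WithTop ℕ∞} :
    ContDiff ℝ n (extremal m : Space d → ℝ) := by
  have h : ContDiff ℝ n (energy m : Space d → ℝ) := by
    unfold energy
    exact (contDiff_const.add (contDiff_norm_sq ℝ)).sqrt fun ξ => by positivity
  unfold extremal
  exact h.neg.exp.div h fun ξ => (energy_pos hm ξ).ne'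

/-- A smooth cutoff which is `1` on the ball of radius `n + 1`. -/
def cutoff (d n : ℕ) : ContDiffBump (0 : Space d) := ⟨n + 1, n + 2, by positivity, by linarith⟩

/-- The truncated extremal profile as a Schwartz function. -/
def truncatedExtremal (d : ℕ) {m : ℝ} (hm : 0 < m) (n : ℕ) : 𝓢(Space d, ℂ) :=
  HasCompactSupport.toSchwartzMap (f := fun ξ => ((cutoff d n ξ * extremal m ξ : ℝ) : ℂ))
    (((cutoff d n).hasCompactSupport.mul_right).comp_left Complex.ofReal_zero)
    (Complex.ofRealCLM.contDiff.comp ((cutoff d n).contDiff.mul (contDiff_extremal hm)))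

theorem truncatedExtremal_apply {m : ℝ} (hm : 0 < m) (n : ℕ) (ξ : Space d) :
    truncatedExtremal d hm n ξ = ((cutoff d n ξ * extremal m ξ : ℝ) : ℂ) := rfl

theorem enorm_truncatedExtremal_le {m : ℝ} (hm : 0 < m) (n : ℕ) (ξ : Space d) :
    ‖truncatedExtremal d hm n ξ‖ₑ ≤ ENNReal.ofReal (extremal m ξ) := by
  rw [truncatedExtremal_apply, ← ofReal_norm, Complex.norm_real, Real.norm_of_nonneg
    (mul_nonneg (cutoff d n).nonneg (extremal_pos hm ξ).le)]
  exact ENNReal.ofReal_le_ofReal (mul_le_of_le_one_left (extremal_pos hm ξ).le (cutoff d n).le_one)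

theorem truncatedExtremal_eq {m : ℝ} (hm : 0 < m) {n : ℕ} {ξ : Space d} (h : ‖ξ‖ ≤ n + 1) :
    truncatedExtremal d hm n ξ = (extremal m ξ : ℂ) := by
  rw [truncatedExtremal_apply, (cutoff d n).one_of_mem_closedBall, one_mul]
  rw [mem_closedBall_zero_iff]
  exact h

theorem fourier_toLp_truncatedExtremal {m : ℝ} (hm : 0 < m) (n : ℕ) :
    (𝓕 ((𝓕⁻ (truncatedExtremal d hm n) : 𝓢(Space d, ℂ)).toLp 2) : L2 d) =ᵐ[volume]
      truncatedExtremal d hm n := by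
  rw [SchwartzMap.toLp_fourier_eq, FourierTransform.fourier_fourierInv_eq]
  exact SchwartzMap.coeFn_toLp _ _ _

theorem ae_prod_mul {α : Type*} [MeasurableSpace α] {μ : Measure α} [SigmaFinite μ]
    {f f' : α → ℂ} (h : f =ᵐ[μ] f') :
    ∀ᵐ z ∂(μ.prod μ), f z.1 = f' z.1 ∧ f z.2 = f' z.2 :=
  (Measure.quasiMeasurePreserving_fst.ae h).and (Measure.quasiMeasurePreserving_snd.ae h)

/-- The density of the image of the extremal profile `e^{-ω(ξ)-ω(η)} / (ω(ξ) ω(η))`. -/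
def extremalDensity (m : ℝ) (p : SpaceTime d) : ℝ := Real.exp (-p.fst) * collisionDensity m p

theorem extremalDensity_nonneg (m : ℝ) (p : SpaceTime d) : 0 ≤ extremalDensity m p :=
  mul_nonneg (Real.exp_pos _).le (collisionDensity_nonneg m p)

@[fun_prop]
theorem measurable_extremalDensity (m : ℝ) :
    Measurable (extremalDensity m : SpaceTime d → ℝ) := by
  unfold extremalDensity; fun_prop

theorem integrable_extremalDensity (hd : 2 ≤ d) {m : ℝ} (hm : 0 < m) :
    Integrable (extremalDensity m : SpaceTime d → ℝ) := by
  refine ⟨by fun_prop, ?_⟩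
  rw [hasFiniteIntegral_iff_ofReal (Filter.Eventually.of_forall (extremalDensity_nonneg m))]
  have h := lintegral_momentum_extremal hd hm (h := fun _ => 1) measurable_const
  simp only [one_mul] at h
  unfold extremalDensity
  rw [← h]
  exact (lintegral_extremal_mul_extremal_ne_top hd hm).lt_top

theorem integral_momentum_extremal (hd : 2 ≤ d) {m : ℝ} (hm : 0 < m) {ψ : SpaceTime d → ℂ}
    (hψ : Measurable ψ) :
    ∫ z : Space d × Space d, ((extremal m z.1 * extremal m z.2 : ℝ) : ℂ) * ψ (momentum m z) =
      ∫ p, (extremalDensity m p : ℂ) * ψ p := by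
  have h := congrArg (fun μ => ∫ p, ψ p ∂μ) (map_momentum_extremal hd hm)
  rw [integral_map (continuous_momentum m).measurable.aemeasurable hψ.aestronglyMeasurable,
    integral_withDensity_eq_integral_toReal_smul (by fun_prop) (by simp),
    integral_withDensity_eq_integral_toReal_smul (by fun_prop) (by simp)] at h
  refine Eq.trans (integral_congr_ae (Filter.Eventually.of_forall fun z => ?_))
    (h.trans (integral_congr_ae (Filter.Eventually.of_forall fun p => ?_)))
  · simp only
    rw [ENNReal.toReal_ofReal (mul_pos (extremal_pos hm _) (extremal_pos hm _)).le,
      Complex.real_smul]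
  · simp only
    rw [← extremalDensity, ENNReal.toReal_ofReal (extremalDensity_nonneg m p), Complex.real_smul]

/-- Total energy below n + 1 forces both momenta into the ball where the cutoff is 1. Any admissible
H is treated, since the infimum in `nullFormNormSq` ranges over all of them. -/
theorem hasSpaceTimeFourier_truncated_eq (hd : 2 ≤ d) {s : ℝ} (hm : 0 < s / (2 * Real.pi)) (n : ℕ)
    {H : SpaceTime d → ℂ}
    (hH : HasSpaceTimeFourier (productPP s
      ((𝓕⁻ (truncatedExtremal d hm n) : 𝓢(Space d, ℂ)).toLp 2)
      ((𝓕⁻ (truncatedExtremal d hm n) : 𝓢(Space d, ℂ)).toLp 2)) H) :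
    ∀ᵐ p, p.fst < (n : ℝ) + 1 → H p = (extremalDensity (s / (2 * Real.pi)) p : ℂ) := by
  have hpair := integral_productPP s
    ((𝓕⁻ (truncatedExtremal d hm n) : 𝓢(Space d, ℂ)).toLp 2)
    ((𝓕⁻ (truncatedExtremal d hm n) : 𝓢(Space d, ℂ)).toLp 2)
  have hae := ae_prod_mul (fourier_toLp_truncatedExtremal (d := d) hm n)
  rw [← Measure.volume_eq_prod] at hae
  obtain ⟨hloc, hH⟩ := hH
  set m := s / (2 * Real.pi)
  have hD : Integrable (fun p : SpaceTime d => (extremalDensity m p : ℂ)) :=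
    (integrable_extremalDensity hd hm).ofReal
  set U : Set (SpaceTime d) := {p | p.fst < (n : ℝ) + 1} with hU
  have hUo : IsOpen U := isOpen_lt (by fun_prop) continuous_const
  have hdiff : LocallyIntegrable (fun p => H p - (extremalDensity m p : ℂ)) :=
    hloc.sub hD.locallyIntegrable
  have key := hUo.ae_eq_zero_of_integral_contDiff_smul_eq_zero (hdiff.locallyIntegrableOn U)
    fun g hg hgs hgU => ?_
  · filter_upwards [key] with p hp hpU
    exact sub_eq_zero.1 (hp hpU)
  have hg₁ : HasCompactSupport (Complex.ofRealCLM ∘ g) := hgs.comp_left rfl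
  have hg₂ : ContDiff ℝ (⊤ : ℕ∞) (Complex.ofRealCLM ∘ g) := by fun_prop
  set ψ : 𝓢(SpaceTime d, ℂ) := hg₁.toSchwartzMap hg₂ with hψ
  have hψg (x : SpaceTime d) : ψ x = (g x : ℂ) := rfl
  have hI1 : Integrable fun p => g p • H p :=
    hloc.integrable_smul_left_of_hasCompactSupport hg.continuous hgs
  have hI2 : Integrable fun p => g p • (extremalDensity m p : ℂ) :=
    hD.locallyIntegrable.integrable_smul_left_of_hasCompactSupport hg.continuous hgs
  simp only [smul_sub]
  rw [integral_sub hI1 hI2, sub_eq_zero]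
  calc ∫ p, g p • H p = ∫ p, H p * ψ p := by simp only [hψg, Complex.real_smul, mul_comm]
    _ = ∫ z : Space d × Space d, ((extremal m z.1 * extremal m z.2 : ℝ) : ℂ) * ψ (momentum m z) := by
      rw [← hH ψ hg₁, hpair ψ hg₁]
      refine integral_congr_ae ?_
      filter_upwards [hae] with z hz
      rw [hz.1, hz.2]
      by_cases h0 : g (momentum m z) = 0
      · rw [hψg, h0]; simp
      · have h1 : momentum m z ∈ U := hgU (subset_tsupport _ h0)
        have h2 : energy m z.1 + energy m z.2 < (n : ℝ) + 1 := h1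
        have e1 := norm_le_energy m z.1
        have e2 := norm_le_energy m z.2
        have e3 := norm_nonneg z.1
        have e4 := norm_nonneg z.2
        rw [truncatedExtremal_eq hm (by linarith), truncatedExtremal_eq hm (by linarith)]
        push_cast
        rfl
    _ = ∫ p, (extremalDensity m p : ℂ) * ψ p :=
      integral_momentum_extremal hd hm ψ.continuous.measurable
    _ = _ := by simp only [hψg, Complex.real_smul, mul_comm]

/-- The common integrand of both sides of the inequality for the extremal profile. -/
def extremalIntegrand (s β : ℝ) (p : SpaceTime d) : ℝ≥0∞ :=
  ENNReal.ofReal (nullSymbol s p ^ (2 * β) * extremalDensity (s / (2 * Real.pi)) p ^ 2)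

theorem le_nullFormNormSq_truncated (hd : 2 ≤ d) {s : ℝ} (hm : 0 < s / (2 * Real.pi)) (β : ℝ)
    (n : ℕ) :
    ∫⁻ p in {p : SpaceTime d | p.fst < (n : ℝ) + 1}, extremalIntegrand s β p ≤
      nullFormNormSq s β (productPP s
        ((𝓕⁻ (truncatedExtremal d hm n) : 𝓢(Space d, ℂ)).toLp 2)
        ((𝓕⁻ (truncatedExtremal d hm n) : 𝓢(Space d, ℂ)).toLp 2)) := by
  refine le_iInf₂ fun G hG => ?_
  obtain ⟨H, hH, hGH⟩ := hG
  have h1 := hasSpaceTimeFourier_truncated_eq hd hm n hH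
  rw [← enorm_fourier_L2ST, enorm_sq_L2ST]
  refine le_trans ?_ (setLIntegral_le_lintegral {p : SpaceTime d | p.fst < (n : ℝ) + 1} _)
  refine le_of_eq (setLIntegral_congr_fun_ae (measurableSet_lt (by fun_prop) measurable_const) ?_)
  filter_upwards [h1, hGH] with p hp1 hp2 hpU
  rw [hp2, hp1 hpU, enorm_rpow_mul_sq (nullSymbol_nonneg s p), extremalIntegrand,
    ENNReal.ofReal_mul (Real.rpow_nonneg (nullSymbol_nonneg s p) _),
    ENNReal.ofReal_pow (extremalDensity_nonneg _ p), ← ofReal_norm, Complex.norm_real,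
    Real.norm_of_nonneg (extremalDensity_nonneg _ p)]

theorem ae_fst_ne_snd (hd : 2 ≤ d) : ∀ᵐ z : Space d × Space d, z.1 ≠ z.2 := by
  have : Nontrivial (Space d) := by
    have : Nontrivial (Fin d) := Fin.nontrivial_iff_two_le.2 hd
    infer_instance
  rw [Measure.volume_eq_prod, Measure.ae_prod_iff_ae_ae]
  · refine Filter.Eventually.of_forall fun ξ => ?_
    have : ∀ᵐ η : Space d, η ≠ ξ := by simp [ae_iff]
    filter_upwards [this] with η hη using hη.symm
  · exact (measurableSet_eq_fun measurable_fst measurable_snd).compl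

/-- The cutoffs are at most 1, so the full profile dominates. For it the pointwise identity leaves a
function of the total momentum times the extremal measure, which pushes forward to the other side of
the inequality. -/
theorem mul_dataIntegral_truncated_le (hd : 2 ≤ d) {s : ℝ} (hs : 0 < s)
    (hm : 0 < s / (2 * Real.pi)) (β : ℝ) (n : ℕ) :
    ENNReal.ofReal (KGpp β d) * dataIntegral s β
        ((𝓕⁻ (truncatedExtremal d hm n) : 𝓢(Space d, ℂ)).toLp 2)
        ((𝓕⁻ (truncatedExtremal d hm n) : 𝓢(Space d, ℂ)).toLp 2) ≤
      ∫⁻ p : SpaceTime d, extremalIntegrand s β p := by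
  have hae := ae_prod_mul (fourier_toLp_truncatedExtremal (d := d) hm n)
  rw [← Measure.volume_eq_prod] at hae
  have hW := lintegral_momentum_extremal hd hm (h := fun p : SpaceTime d => ENNReal.ofReal
    (nullSymbol s p ^ (2 * β) * extremalDensity (s / (2 * Real.pi)) p)) (by fun_prop)
  rw [dataIntegral_eq, ← lintegral_const_mul' _ _ ENNReal.ofReal_ne_top]
  calc _ ≤ ∫⁻ z : Space d × Space d, ENNReal.ofReal (nullSymbol s (momentum (s / (2 * Real.pi)) z) ^
          (2 * β) * extremalDensity (s / (2 * Real.pi)) (momentum (s / (2 * Real.pi)) z)) *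
          ENNReal.ofReal (extremal (s / (2 * Real.pi)) z.1 * extremal (s / (2 * Real.pi)) z.2) := by
        refine lintegral_mono_ae ?_
        filter_upwards [hae, ae_fst_ne_snd hd] with z hz hne
        rw [hz.1, hz.2, ← mul_assoc, ← ENNReal.ofReal_mul (KGpp_pos hd β).le,
          ← nullSymbol_mul_collisionDensity hd hs β hne]
        set m := s / (2 * Real.pi)
        have hx := extremal_pos hm z.1
        have hy := extremal_pos hm z.2
        have e1 := energy_pos hm z.1
        have e2 := energy_pos hm z.2
        calc _ ≤ ENNReal.ofReal (nullSymbol s (momentum m z) ^ (2 * β) *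
              collisionDensity m (momentum m z) * (energy m z.1 * energy m z.2)) *
              (ENNReal.ofReal (extremal m z.1) ^ 2 * ENNReal.ofReal (extremal m z.2) ^ 2) := by
              gcongr <;> exact enorm_truncatedExtremal_le hm n _
          _ = ENNReal.ofReal (nullSymbol s (momentum m z) ^ (2 * β) *
              collisionDensity m (momentum m z) * (energy m z.1 * energy m z.2) *
              (extremal m z.1 * extremal m z.2)) *
              ENNReal.ofReal (extremal m z.1 * extremal m z.2) := by
              rw [← mul_pow, ← ENNReal.ofReal_mul hx.le, pow_two, ← mul_assoc,
                ← ENNReal.ofReal_mul' (mul_pos hx hy).le]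
          _ = _ := by
              congr 2
              rw [extremal_mul_extremal, extremalDensity]
              field_simp
              rw [show s / (2 * Real.pi) = m from rfl]
              ring
    _ = _ := by
        rw [hW]
        refine lintegral_congr fun p => ?_
        rw [← extremalDensity, ← ENNReal.ofReal_mul' (extremalDensity_nonneg _ p),
          extremalIntegrand]
        congr 1
        ring

@[fun_prop]
theorem measurable_extremalIntegrand (s β : ℝ) :
    Measurable (extremalIntegrand s β : SpaceTime d → ℝ≥0∞) := by
  unfold extremalIntegrand; fun_prop

theorem lintegral_extremalIntegrand_ne_zero (hd : 2 ≤ d) {s : ℝ} (hs : 0 < s) (β : ℝ) :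
    ∫⁻ p : SpaceTime d, extremalIntegrand s β p ≠ 0 := by
  have hm : 0 < s / (2 * Real.pi) := by positivity
  have : Nontrivial (Space d) := by
    have : Nontrivial (Fin d) := Fin.nontrivial_iff_two_le.2 hd
    infer_instance
  rw [← pos_iff_ne_zero, lintegral_pos_iff_support (by fun_prop)]
  set U : Set (SpaceTime d) :=
    {p | Real.sqrt (4 * (s / (2 * Real.pi)) ^ 2 + ‖p.snd‖ ^ 2) < p.fst} with hU
  have hUo : IsOpen U := isOpen_lt (by fun_prop) (by fun_prop)
  have hUn : U.Nonempty := by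
    refine ⟨WithLp.toLp 2 (Real.sqrt (4 * (s / (2 * Real.pi)) ^ 2 + ‖(0 : Space d)‖ ^ 2) + 1, 0), ?_⟩
    simp [hU]
  refine (hUo.measure_pos volume hUn).trans_le (measure_mono fun p hp => ?_)
  have hp' : Real.sqrt (4 * (s / (2 * Real.pi)) ^ 2 + ‖p.snd‖ ^ 2) < p.fst := hp
  have h1 := Real.lt_sq_of_sqrt_lt hp'
  have h2 : 0 < p.fst ^ 2 - ‖p.snd‖ ^ 2 - 4 * (s / (2 * Real.pi)) ^ 2 := by linarith
  have h3 : 0 < p.fst ^ 2 - ‖p.snd‖ ^ 2 := by nlinarith [pow_pos hm 2]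
  have hσ : 0 < (volume : Measure (Space d)).toSphere.real Set.univ := by
    rw [toSphere_real_univ (by omega)]
    have := Real.Gamma_pos_of_pos (show 0 < (d : ℝ) / 2 by positivity)
    positivity
  have h4 : 0 < nullSymbol s p := by
    rw [nullSymbol_eq]
    positivity
  have h5 : 0 < collisionDensity (s / (2 * Real.pi)) p := by
    rw [collisionDensity, if_pos hp']
    positivity
  rw [Function.mem_support, extremalIntegrand]
  refine (ENNReal.ofReal_pos.2 ?_).ne'
  unfold extremalDensity
  positivity

/-- Staying above b > 0 handles negative exponents; for a > 0, raise y ≤ e^y with y = x/(2a) to the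
power a. -/
theorem exists_rpow_le_mul_exp (a : ℝ) {b : ℝ} (hb : 0 < b) :
    ∃ C : ℝ, 0 ≤ C ∧ ∀ x, b ≤ x → x ^ a ≤ C * Real.exp (x / 2) := by
  rcases le_or_gt a 0 with ha | ha
  · refine ⟨b ^ a, by positivity, fun x hx => ?_⟩
    have h1 := Real.rpow_le_rpow_of_nonpos hb hx ha
    have h2 : 1 ≤ Real.exp (x / 2) := Real.one_le_exp (by linarith)
    exact h1.trans (le_mul_of_one_le_right (by positivity) h2)
  · refine ⟨(2 * a) ^ a, by positivity, fun x hx => ?_⟩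
    have hx0 : 0 < x := hb.trans_le hx
    have h1 : x / (2 * a) ≤ Real.exp (x / (2 * a)) := by
      have := Real.add_one_le_exp (x / (2 * a)); linarith
    calc x ^ a = (2 * a * (x / (2 * a))) ^ a := by congr 1; field_simp
      _ = (2 * a) ^ a * (x / (2 * a)) ^ a := Real.mul_rpow (by positivity) (by positivity)
      _ ≤ (2 * a) ^ a * (Real.exp (x / (2 * a))) ^ a := by gcongr
      _ = _ := by rw [← Real.exp_mul]; congr 2; field_simp

/-- With E = √(4m² + |ζ|²), the integrand behaves like (τ - E)^a near the threshold, a = 2β + d - 2,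
and `hβ` makes a > -1. Elsewhere e^{-2τ} absorbs the growth of (τ + E)^a, leaving a Gamma integral
in τ - E times e^{-|ζ|}. -/
theorem lintegral_extremalIntegrand_ne_top (hd : 2 ≤ d) {s : ℝ} (hs : 0 < s) {β : ℝ}
    (hβ : (3 - 2 * (d : ℝ)) / 4 < β) :
    ∫⁻ p : SpaceTime d, extremalIntegrand s β p ≠ ∞ := by
  have hm : 0 < s / (2 * Real.pi) := by positivity
  unfold extremalIntegrand extremalDensity collisionDensity
  simp only [nullSymbol_eq]
  set m := s / (2 * Real.pi)
  set a : ℝ := 2 * β + ((d : ℝ) - 2) with ha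
  have ha1 : 0 < a + 1 := by rw [ha]; linarith
  obtain ⟨C, hC0, hC⟩ := exists_rpow_le_mul_exp a (show 0 < 2 * m by positivity)
  set σ : ℝ := (volume : Measure (Space d)).toSphere.real Set.univ * 2 ^ (2 - (d : ℝ)) with hσ
  have hσ0 : 0 ≤ σ := by positivity
  set M : ℝ := (2 ^ 2 * Real.pi ^ 2) ^ (2 * β) * (σ ^ 2 / (4 * m ^ 2)) * C with hM
  have hM0 : 0 ≤ M := by positivity
  set h : ℝ → ℝ := (Set.Ioi 0).indicator fun r => Real.exp (-r) * r ^ a with hh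
  have hhm : Measurable h := by
    refine Measurable.indicator ?_ measurableSet_Ioi
    fun_prop
  have hhi : ∫⁻ r, ENNReal.ofReal (h r) ≠ ∞ := by
    have h1 := Real.GammaIntegral_convergent ha1
    rw [← integrable_indicator_iff measurableSet_Ioi] at h1
    simp only [add_sub_cancel_right] at h1
    exact h1.lintegral_lt_top.ne
  have hb (τ : ℝ) (ζ : Space d) : Real.sqrt (4 * m ^ 2 + ‖ζ‖ ^ 2) < τ →
      |2 ^ 2 * Real.pi ^ 2 * (τ ^ 2 - ‖ζ‖ ^ 2 - 4 * m ^ 2)| ^ (2 * β) *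
        (Real.exp (-τ) * (σ * (τ ^ 2 - ‖ζ‖ ^ 2 - 4 * m ^ 2) ^ (((d : ℝ) - 2) / 2) /
          Real.sqrt (τ ^ 2 - ‖ζ‖ ^ 2))) ^ 2 ≤
      M * Real.exp (-‖ζ‖) * h (τ - Real.sqrt (4 * m ^ 2 + ‖ζ‖ ^ 2)) := by
    intro hτ
    have hE2 : Real.sqrt (4 * m ^ 2 + ‖ζ‖ ^ 2) ^ 2 = 4 * m ^ 2 + ‖ζ‖ ^ 2 :=
      Real.sq_sqrt (by positivity)
    have hE1 : ‖ζ‖ ≤ Real.sqrt (4 * m ^ 2 + ‖ζ‖ ^ 2) :=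
      Real.le_sqrt_of_sq_le (by nlinarith [sq_nonneg m])
    have hE3 : 2 * m ≤ Real.sqrt (4 * m ^ 2 + ‖ζ‖ ^ 2) :=
      Real.le_sqrt_of_sq_le (by nlinarith [sq_nonneg ‖ζ‖])
    set E := Real.sqrt (4 * m ^ 2 + ‖ζ‖ ^ 2)
    have hr : 0 < τ - E := sub_pos.2 hτ
    have hX : τ ^ 2 - ‖ζ‖ ^ 2 - 4 * m ^ 2 = (τ - E) * (τ + E) := by
      have : (τ - E) * (τ + E) = τ ^ 2 - E ^ 2 := by ring
      rw [this, hE2]; ring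
    have hs' : 0 < τ + E := by linarith
    have hX0 : 0 < (τ - E) * (τ + E) := mul_pos hr hs'
    have hY : 4 * m ^ 2 ≤ τ ^ 2 - ‖ζ‖ ^ 2 := by linarith [hX]
    have hhr : h (τ - E) = Real.exp (-(τ - E)) * (τ - E) ^ a :=
      Set.indicator_of_mem (Set.mem_Ioi.2 hr) _
    rw [hX, hhr, abs_of_pos (by positivity), Real.mul_rpow (by positivity) hX0.le, mul_pow, div_pow,
      mul_pow, Real.sq_sqrt (by nlinarith [sq_nonneg m]), ← Real.rpow_natCast (_ ^ (((d : ℝ) - 2) / 2)) 2,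
      ← Real.rpow_mul hX0.le, ← Real.exp_nat_mul]
    have e1 : ((τ - E) * (τ + E)) ^ (2 * β) * ((τ - E) * (τ + E)) ^ (((d : ℝ) - 2) / 2 * (2 : ℕ)) =
        (τ - E) ^ a * (τ + E) ^ a := by
      rw [← Real.rpow_add hX0, ← Real.mul_rpow hr.le hs'.le]
      congr 1
      rw [ha]; push_cast; ring
    have e2 : (τ + E) ^ a ≤ C * Real.exp ((τ + E) / 2) := hC _ (by linarith)
    -- The exponents compare because |ζ| ≤ E < τ, hence |ζ| ≤ (τ + E)/2.
    have e3 : Real.exp ((2 : ℕ) * -τ) * Real.exp ((τ + E) / 2) ≤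
        Real.exp (-‖ζ‖) * Real.exp (-(τ - E)) := by
      rw [← Real.exp_add, ← Real.exp_add]
      apply Real.exp_le_exp.2
      push_cast
      linarith
    calc _ = (2 ^ 2 * Real.pi ^ 2) ^ (2 * β) * (σ ^ 2 / (τ ^ 2 - ‖ζ‖ ^ 2)) *
          (Real.exp ((2 : ℕ) * -τ) * (((τ - E) * (τ + E)) ^ (2 * β) *
            ((τ - E) * (τ + E)) ^ (((d : ℝ) - 2) / 2 * (2 : ℕ)))) := by ring
      _ = (2 ^ 2 * Real.pi ^ 2) ^ (2 * β) * (σ ^ 2 / (τ ^ 2 - ‖ζ‖ ^ 2)) *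
          (Real.exp ((2 : ℕ) * -τ) * ((τ - E) ^ a * (τ + E) ^ a)) := by rw [e1]
      _ ≤ (2 ^ 2 * Real.pi ^ 2) ^ (2 * β) * (σ ^ 2 / (4 * m ^ 2)) *
          (Real.exp ((2 : ℕ) * -τ) * ((τ - E) ^ a * (C * Real.exp ((τ + E) / 2)))) := by gcongr
      _ = M * (τ - E) ^ a * (Real.exp ((2 : ℕ) * -τ) * Real.exp ((τ + E) / 2)) := by
        rw [hM]; ring
      _ ≤ M * (τ - E) ^ a * (Real.exp (-‖ζ‖) * Real.exp (-(τ - E))) := by gcongr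
      _ = _ := by ring
  refine ne_top_of_le_ne_top (b := ∫⁻ ζ : Space d, ENNReal.ofReal (M * Real.exp (-‖ζ‖)) *
    ∫⁻ r, ENNReal.ofReal (h r)) ?_ ?_
  · rw [lintegral_mul_const _ (by fun_prop)]
    exact ENNReal.mul_ne_top ((integrable_exp_neg_norm hd).const_mul M).lintegral_lt_top.ne hhi
  rw [← (WithLp.volume_preserving_toLp ℝ (Space d)).lintegral_comp_emb
    (MeasurableEquiv.toLp 2 _).measurableEmbedding]
  calc _ ≤ ∫⁻ p : ℝ × Space d, ENNReal.ofReal (M * Real.exp (-‖p.2‖)) *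
        ENNReal.ofReal (h (p.1 - Real.sqrt (4 * m ^ 2 + ‖p.2‖ ^ 2))) := by
        refine lintegral_mono fun p => ?_
        rw [← ENNReal.ofReal_mul (by positivity)]
        by_cases hτ : Real.sqrt (4 * m ^ 2 + ‖(WithLp.toLp 2 p : SpaceTime d).snd‖ ^ 2) <
            (WithLp.toLp 2 p : SpaceTime d).fst
        · rw [if_pos hτ]
          exact ENNReal.ofReal_le_ofReal (hb _ _ hτ)
        · rw [if_neg hτ, mul_zero, zero_pow two_ne_zero, mul_zero, ENNReal.ofReal_zero]
          exact zero_le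
    _ = _ := by
        rw [Measure.volume_eq_prod, lintegral_prod_symm _ (by fun_prop)]
        refine lintegral_congr fun ζ => ?_
        simp only
        rw [lintegral_const_mul _ (by fun_prop),
          lintegral_sub_right_eq_self (fun r => ENNReal.ofReal (h r))]

theorem mul_le_mul_of_dual_bounds {K C I N D M : ℝ≥0∞} (h₁ : I ≤ N) (h₂ : N ≤ C * D)
    (h₃ : K * D ≤ M) : K * I ≤ C * M :=
  calc K * I ≤ K * (C * D) := mul_le_mul' le_rfl (h₁.trans h₂)
    _ = C * (K * D) := mul_left_comm _ _ _
    _ ≤ C * M := mul_le_mul' le_rfl h₃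

theorem KGpp_le_of_forall_schwartz (hd : 2 ≤ d) {s : ℝ} (hs : 0 < s) {β : ℝ}
    (hβ : (3 - 2 * (d : ℝ)) / 4 < β) {C : ℝ≥0∞}
    (hC : ∀ f g : 𝓢(Space d, ℂ), nullFormNormSq s β (productPP s (f.toLp 2) (g.toLp 2)) ≤
      C * dataIntegral s β (f.toLp 2) (g.toLp 2)) :
    ENNReal.ofReal (KGpp β d) ≤ C := by
  have hm : 0 < s / (2 * Real.pi) := by positivity
  set U : ℕ → Set (SpaceTime d) := fun n => {p | p.fst < (n : ℝ) + 1} with hU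
  set M := ∫⁻ p : SpaceTime d, extremalIntegrand s β p with hM
  have hbound (n : ℕ) : ENNReal.ofReal (KGpp β d) * ∫⁻ p in U n, extremalIntegrand s β p ≤
      C * M :=
    mul_le_mul_of_dual_bounds (le_nullFormNormSq_truncated hd hm β n) (hC _ _)
      (mul_dataIntegral_truncated_le hd hs hm β n)
  have hmono : Monotone U := by
    intro i j hij
    have : (i : ℝ) ≤ j := Nat.cast_le.2 hij
    exact fun p (hp : p.fst < _) => hp.trans_le (add_le_add_left this 1)
  have hunion : ⋃ n, U n = Set.univ := by
    refine Set.eq_univ_of_forall fun p => Set.mem_iUnion.2 ?_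
    obtain ⟨n, hn⟩ := exists_nat_ge p.fst
    exact ⟨n, hn.trans_lt (lt_add_one _)⟩
  have hsup : M = ⨆ n, ∫⁻ p in U n, extremalIntegrand s β p := by
    rw [← setLIntegral_iUnion_of_directed _ (directed_of_isDirected_le hmono), hunion,
      setLIntegral_univ]
  have hfin : ENNReal.ofReal (KGpp β d) * M ≤ C * M := by
    conv_lhs => rw [hsup, ENNReal.mul_iSup]
    exact iSup_le hbound
  -- Cancelling M in [0, ∞] needs both M ≠ 0 and M ≠ ∞.
  exact (ENNReal.mul_le_mul_iff_left (lintegral_extremalIntegrand_ne_zero hd hs β)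
    (lintegral_extremalIntegrand_ne_top hd hs hβ)).1 hfin

end

end KleinGordon

end

theorem mainTheorem5 (d : ℕ) (hd : 2 ≤ d) (s : ℝ) (hs : 0 < s) (β : ℝ)
    (hβ : (3 - 2 * (d : ℝ)) / 4 < β) :
    (∀ f g : KleinGordon.L2 d,
      KleinGordon.nullFormNormSq s β (KleinGordon.productPP s f g) ≤
        ENNReal.ofReal (KleinGordon.KGpp β d) * KleinGordon.dataIntegral s β f g) ∧
    (∀ C : ℝ≥0∞,
      (∀ f g : 𝓢(KleinGordon.Space d, ℂ),
        KleinGordon.nullFormNormSq s β (KleinGordon.productPP s (f.toLp 2) (g.toLp 2)) ≤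
          C * KleinGordon.dataIntegral s β (f.toLp 2) (g.toLp 2)) →
      ENNReal.ofReal (KleinGordon.KGpp β d) ≤ C) :=
  ⟨fun f g => KleinGordon.nullFormNormSq_productPP_le hd hs β f g,
    fun _ hC => KleinGordon.KGpp_le_of_forall_schwartz hd hs hβ hC⟩
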